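/- **Model.** A network is a connected undirected graph $G$ with $n$ nodes, each named by a unique ID in $\{1,\dots,n^{a}\}$, and with edge weights $w:E(G)\to\{1,\dots,n^{a}\}$, where $a$ is a constant. In the (synchronous, randomized) CONGEST model each node initially knows $n$, its own ID, the IDs of its neighbours, the weights of its incident edges, the ID of the source $s$, and a common number $\tilde D$ with $D\le \tilde D\le 2D$, where $D$ is the hop diameter, i.e. the diameter of the unweighted graph $G$. It also has a private string of independent fair random bits. Local computation is free. In every round each node may send a (possibly different) message of $O(\log n)$ bits to each of its neighbours, which arrives at the end of the round. $\operatorname{dist}_{G,w}(s,v)$ denotes the minimum total weight of an $s$-$v$ path. **Theorem.** For every constant $a$ one can fix a bandwidth of $O(\log n)$ bits (the hidden constant depending only on $a$) such that for every constant $c$ there are a randomized CONGEST algorithm, a function $\varepsilon(n)$ with $\varepsilon(n)\to 0$ as $n\to\infty$, and constants $C,k$ for which the following holds. For every $n$, every weighted $n$-node network $(G,w)$ as above with hop diameter $D$, and every source $s$, with probability at least $1-1/n^{c}$ all nodes halt within $$C\,(\log n)^{k}\,\bigl(n^{1/2}D^{1/4}+D\bigr)=\tilde O\bigl(n^{1/2}D^{1/4}+D\bigr)$$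 rounds, and every node $v$ outputs a value $d(v)$ with $$\operatorname{dist}_{G,w}(s,v)\;\le\; d(v)\;\le\;(1+\varepsilon(n))\,\operatorname{dist}_{G,w}(s,v).$$ -/

import Mathlib

open Filter Topology ProbabilityTheory

noncomputable section

/-- A connected weighted network on `n` nodes. Nodes are named by their IDs, so the node set is a
set of `n` natural numbers; IDs and edge weights lie in `{1, …, n ^ a}`. -/
structure WeightedNetwork (n a : ℕ) where
  V : Finset ℕ
  card_V : V.card = n
  id_range : V ⊆ Finset.Icc 1 (n ^ a)
  graph : SimpleGraph V
  connected : graph.Connected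
  weight : Sym2 V → ℕ
  weight_range : ∀ e ∈ graph.edgeSet, weight e ∈ Finset.Icc 1 (n ^ a)

namespace WeightedNetwork

variable {n a : ℕ} (N : WeightedNetwork n a)

/-- The weight of a path: the sum of the weights of its edges. -/
def pathWeight {u v : N.V} (p : N.graph.Walk u v) : ℕ :=
  (p.edges.map N.weight).sum

/-- The weighted distance: the minimum weight of a `u`-`v` path
(a minimum over a nonempty set, since the network is connected). -/
def wdist (u v : N.V) : ℕ :=
  ⨅ p : N.graph.Walk u v, N.pathWeight p

/-- The hop diameter: the diameter of the underlying unweighted graph. -/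
def hopDiam : ℕ := N.graph.diam

end WeightedNetwork

/-- Everything a node knows at the beginning, apart from the number `n` of nodes:
its own ID, the ID of the source, an estimate of the hop diameter, and, for every ID `i`,
whether `i` is the ID of a neighbour (`nbr i ≠ none`) and if so the weight of that edge
(`nbr i = some w`). -/
structure LocalInput where
  self : ℕ
  source : ℕ
  diamEstimate : ℕ
  nbr : ℕ → Option ℕ

/-- A node is either still running, with some internal state, or it has halted with an output. -/
inductive Status (σ : Type) where
  | running (q : σ) : Status σ
  | halted (out : ℚ) : Status σ

/-- A randomized synchronous message-passing algorithm with messages of `B` bits, in which every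
node has a private string of `R` random bits. Local computation is unrestricted. In a round, a
running node in state `q` sends the message `send q i` to its neighbour with ID `i` (`none`: no
message); `step` maps its state and the received messages, indexed by the IDs of the senders, to
its new status. -/
structure CongestAlgorithm (B R : ℕ) where
  State : Type
  start : LocalInput → (Fin R → Bool) → Status State
  send : State → ℕ → Option (BitVec B)
  step : State → (ℕ → Option (BitVec B)) → Status State

namespace CongestAlgorithm

variable {n a B R : ℕ} (A : CongestAlgorithm B R) (N : WeightedNetwork n a)

open Classical in
/-- The initial knowledge of node `v`. -/
def localInput (N : WeightedNetwork n a) (s : N.V) (diamEst : ℕ) (v : N.V) : LocalInput where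
  self := v
  source := s
  diamEstimate := diamEst
  nbr := fun i =>
    if h : i ∈ N.V then
      if N.graph.Adj v ⟨i, h⟩ then some (N.weight s(v, ⟨i, h⟩)) else none
    else none

/-- The message that a node of the given status sends to its neighbour with ID `i`.
Halted nodes send nothing. -/
def outgoing : Status A.State → ℕ → Option (BitVec B)
  | .running q, i => A.send q i
  | .halted _, _ => none

open Classical in
/-- The messages received by node `v`, indexed by the ID of the sender, if the nodes have the
statuses `S` at the beginning of the round. Only neighbours can be heard. -/
def inbox (S : N.V → Status A.State) (v : N.V) (i : ℕ) : Option (BitVec B) :=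
  if h : i ∈ N.V then
    if N.graph.Adj ⟨i, h⟩ v then A.outgoing (S ⟨i, h⟩) v else none
  else none

/-- One synchronous round. Halted nodes remain halted. -/
def round (S : N.V → Status A.State) (v : N.V) : Status A.State :=
  match S v with
  | .running q => A.step q (A.inbox N S v)
  | .halted out => .halted out

/-- The statuses of all nodes after `t` rounds, where `ω v` is the random string of node `v`. -/
def run (s : N.V) (diamEst : ℕ) (ω : N.V → Fin R → Bool) : ℕ → N.V → Status A.State
  | 0 => fun v => A.start (localInput N s diamEst v) (ω v)
  | t + 1 => A.round N (run s diamEst ω t)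

/-- In the execution with random strings `ω`, all nodes halt within `τ` rounds and the outputs
`α`-approximate the distances from the source `s`. -/
def SolvesSSSPWithin (s : N.V) (diamEst : ℕ) (ω : N.V → Fin R → Bool) (α τ : ℝ) : Prop :=
  ∃ T : ℕ, (T : ℝ) ≤ τ ∧ ∀ v : N.V, ∃ d : ℚ,
    A.run N s diamEst ω T v = .halted d ∧
    (N.wdist s v : ℝ) ≤ (d : ℝ) ∧ (d : ℝ) ≤ α * (N.wdist s v : ℝ)

end CongestAlgorithm

end

/-! Write `log` for `Nat.clog 2 n` and ignore logarithmic factors in the estimates below. Every node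
joins a sample with probability about `1 / (n^{1/2} D^{1/4})`, and the source always belongs to it.
With high probability the sample has at most `M ≈ n^{1/2} / D^{1/4}` nodes (plus a logarithm), and
every node has a sampled node at most `h ≈ n^{1/2} D^{1/4}` hops before it on some shortest path
from the source (`card_bad_sample_le`). So it suffices to approximate the distances from the sample
over few hops, and the distances from the source to the sample.

Both tasks are made cheap by rounding. If the weights are divided by `2 ^ i` and rounded up, with
`i` chosen for the length of the path, then a path of at most `h` hops has rounded weight at most `h
* (K + 1)` and suffers an error factor of at most `1 + 2 / K` (`WPath.exists_scale`). All `O(log n)`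
scales are tried, each in its own phase. Rounding up never underestimates, so taking minima is safe.
The precision is `K = log`, and the two levels of rounding give the factor `((K + 2) / K) ^ 2`,
which tends to 1.

The approximate few-hop distances between sampled nodes form an overlay graph. One unit of overlay
weight costs about `D` rounds, because an overlay step is simulated by a broadcast, so shortest
overlay paths must have few hops. To this end every sampled node publishes its `k` lightest overlay
edges, and each node computes shortcuts in the published graph locally. Balls with more than `k`
vertices around the vertices of a shortest overlay path show that `O(M / k)` hops then suffice
(`exists_few_hops`).

All communication runs through one pipelined primitive: a node sends a token in the round equal to
its key plus its rank. With `m` tokens, all keys up to `W` are then found in `W + m` rounds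
(`exists_mem_tables`). The costs are about `h + M` for detection, `D + M k` for publishing and `D *
M / k + D + M` for the overlay; `k ≈ √D` balances them to `n^{1/2} D^{1/4} + D`. -/

noncomputable section

/-! ### Weighted hop paths -/

/-- `WPath E u h v W`: there is a path of `h` hops and total weight `W` from `u` to `v`, where
`E x y w` says that there is an edge of weight `w` from `x` to `y`. -/
inductive WPath {α : Type*} (E : α → α → ℕ → Prop) (u : α) : ℕ → α → ℕ → Prop
  | nil : WPath E u 0 u 0
  | snoc {h : ℕ} {v x : α} {W w : ℕ} :
      WPath E u h v W → E v x w → WPath E u (h + 1) x (W + w)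

namespace WPath

variable {α β : Type*} {E F : α → α → ℕ → Prop}

theorem single {u v : α} {w : ℕ} (h : E u v w) : WPath E u 1 v w := by
  simpa using WPath.nil.snoc h

theorem trans {h₁ h₂ W₁ W₂ : ℕ} {u v x : α} (p : WPath E u h₁ v W₁) (q : WPath E v h₂ x W₂) :
    WPath E u (h₁ + h₂) x (W₁ + W₂) := by
  induction q with
  | nil => simpa using p
  | snoc _ e ih => simpa only [← add_assoc] using ih.snoc e

theorem cons {h w W : ℕ} {u v x : α} (e : E u v w) (q : WPath E v h x W) :
    WPath E u (h + 1) x (w + W) := by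
  simpa only [add_comm 1 h] using (single e).trans q

theorem symm (hE : ∀ u v w, E u v w → E v u w) {h W : ℕ} {u v : α} (p : WPath E u h v W) :
    WPath E v h u W := by
  induction p with
  | nil => exact .nil
  | snoc _ e ih => simpa only [add_comm] using cons (hE _ _ _ e) ih

theorem mono (hEF : ∀ u v w, E u v w → F u v w) {h W : ℕ} {u v : α} (p : WPath E u h v W) :
    WPath F u h v W := by
  induction p with
  | nil => exact .nil
  | snoc _ e ih => exact ih.snoc (hEF _ _ _ e)

theorem map {G : β → β → ℕ → Prop} (f : α → β) (hEG : ∀ u v w, E u v w → G (f u) (f v) w)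
    {h W : ℕ} {u v : α} (p : WPath E u h v W) : WPath G (f u) h (f v) W := by
  induction p with
  | nil => exact .nil
  | snoc _ e ih => exact ih.snoc (hEG _ _ _ e)

theorem hops_le (hE : ∀ u v w, E u v w → 1 ≤ w) {h W : ℕ} {u v : α} (p : WPath E u h v W) :
    h ≤ W := by
  induction p with
  | nil => exact le_rfl
  | snoc _ e ih => have := hE _ _ _ e; omega

theorem eq_of_weight_zero (hE : ∀ u v w, E u v w → 1 ≤ w) {h : ℕ} {u v : α}
    (p : WPath E u h v 0) : u = v := by
  obtain rfl : h = 0 := Nat.le_zero.1 (p.hops_le hE)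
  cases p; rfl

theorem mem_of_edges {S : Set α} (hE : ∀ u v w, E u v w → v ∈ S) {h W : ℕ} {u v : α}
    (p : WPath E u h v W) (hu : u ∈ S) : v ∈ S := by
  cases p with
  | nil => exact hu
  | snoc _ e => exact hE _ _ _ e

/-- The vertices of a path together with their cumulative weights. -/
theorem exists_sequence {h W : ℕ} {u v : α} (p : WPath E u h v W) :
    ∃ (x : ℕ → α) (c : ℕ → ℕ), x 0 = u ∧ x h = v ∧ c 0 = 0 ∧ c h = W ∧
      ∀ i < h, ∃ w, E (x i) (x (i + 1)) w ∧ c (i + 1) = c i + w := by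
  induction p with
  | nil => exact ⟨fun _ => u, fun _ => 0, by simp⟩
  | @snoc h v y W w _ e ih =>
    obtain ⟨x, c, h0, hh, c0, ch, hs⟩ := ih
    refine ⟨Function.update x (h + 1) y, Function.update c (h + 1) (W + w), ?_, by simp, ?_,
      by simp, fun i hi => ?_⟩
    · simpa [Function.update_apply] using h0
    · simpa [Function.update_apply] using c0
    · rcases Nat.lt_succ_iff_lt_or_eq.1 hi with hi | rfl
      · obtain ⟨w', e', hc⟩ := hs i hi
        refine ⟨w', ?_, ?_⟩
        · simpa [Function.update_apply, hi.ne, (Nat.lt_succ_of_lt hi).ne] using e'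
        · simpa [Function.update_apply, hi.ne, (Nat.lt_succ_of_lt hi).ne] using hc
      · exact ⟨w, by simpa [Function.update_apply, hh] using e,
          by simp [ch]⟩

theorem of_sequence {x : ℕ → α} {c : ℕ → ℕ} {m : ℕ}
    (hs : ∀ i < m, ∃ w, E (x i) (x (i + 1)) w ∧ c (i + 1) = c i + w) {i j : ℕ} (hij : i ≤ j)
    (hj : j ≤ m) : c i ≤ c j ∧ WPath E (x i) (j - i) (x j) (c j - c i) := by
  induction j, hij using Nat.le_induction with
  | base => simpa using WPath.nil (E := E) (u := x i)
  | succ j hij ih =>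
    obtain ⟨hc, p⟩ := ih (by omega)
    obtain ⟨w, e, hw⟩ := hs j (by omega)
    refine ⟨by omega, ?_⟩
    have := p.snoc e
    rwa [show j - i + 1 = j + 1 - i by omega, show c j - c i + w = c (j + 1) - c i by omega]
      at this

end WPath

/-! ### Rounding the weights -/

/-- `w / 2 ^ i`, rounded up. -/
def ceilShift (i w : ℕ) : ℕ := (w + 2 ^ i - 1) / 2 ^ i

theorem le_two_pow_mul_ceilShift (i w : ℕ) : w ≤ 2 ^ i * ceilShift i w := by
  have h := Nat.div_add_mod (w + 2 ^ i - 1) (2 ^ i)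
  have h' := Nat.mod_lt (w + 2 ^ i - 1) (Nat.two_pow_pos i)
  have := Nat.two_pow_pos i
  unfold ceilShift; omega

theorem two_pow_mul_ceilShift_le (i w : ℕ) : 2 ^ i * ceilShift i w ≤ w + (2 ^ i - 1) := by
  have h := Nat.div_add_mod (w + 2 ^ i - 1) (2 ^ i)
  have := Nat.two_pow_pos i
  unfold ceilShift; omega

theorem one_le_ceilShift {i w : ℕ} (hw : 1 ≤ w) : 1 ≤ ceilShift i w := by
  have := le_two_pow_mul_ceilShift i w
  by_contra h
  have h0 : ceilShift i w = 0 := by omega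
  rw [h0] at this; omega

/-- The edges of `E` with weights divided by `2 ^ i` and rounded up. -/
def Rounded {α : Type*} (i : ℕ) (E : α → α → ℕ → Prop) (u v : α) (t : ℕ) : Prop :=
  ∃ w, E u v w ∧ t = ceilShift i w

namespace WPath

variable {α : Type*} {E : α → α → ℕ → Prop}

theorem of_rounded {i h t : ℕ} {u v : α} (p : WPath (Rounded i E) u h v t) :
    ∃ W ≤ 2 ^ i * t, WPath E u h v W := by
  induction p with
  | nil => exact ⟨0, by simp, .nil⟩
  | snoc _ e ih =>
    obtain ⟨W, hW, q⟩ := ih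
    obtain ⟨w, ew, rfl⟩ := e
    have := le_two_pow_mul_ceilShift i w
    exact ⟨W + w, by rw [mul_add]; omega, q.snoc ew⟩

/-- Each edge loses at most `2 ^ i - 1` to rounding up, so the error is governed by the number of
hops. -/
theorem rounded {h W : ℕ} {u v : α} (i : ℕ) (p : WPath E u h v W) :
    ∃ t, 2 ^ i * t ≤ W + h * (2 ^ i - 1) ∧ WPath (Rounded i E) u h v t := by
  induction p with
  | nil => exact ⟨0, by simp, .nil⟩
  | @snoc h v x W w _ e ih =>
    obtain ⟨t, ht, q⟩ := ih
    have := two_pow_mul_ceilShift_le i w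
    exact ⟨t + ceilShift i w, by rw [mul_add, add_mul, one_mul]; omega, q.snoc ⟨w, e, rfl⟩⟩

/-- A path with few hops has, on a suitable scale, small rounded weight and small rounding
error. -/
theorem exists_scale {h h' I K W : ℕ} {u v : α} (p : WPath E u h' v W) (hh : h' ≤ h)
    (hW : W ≤ 2 ^ I * (h * K)) :
    ∃ i ≤ I, ∃ t ≤ h * (K + 1), WPath (Rounded i E) u h' v t ∧
      K * (2 ^ i * t) ≤ (K + 2) * W := by
  classical
  have hex : ∃ i, W ≤ 2 ^ i * (h * K) := ⟨I, hW⟩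
  -- The least scale is used: the upper bound on `W` keeps `t` small, while failure at `i - 1` makes
  -- the rounding error `h * 2 ^ i` at most `2 * W / K`.
  obtain ⟨i, hi, hmin⟩ : ∃ i, W ≤ 2 ^ i * (h * K) ∧ ∀ j < i, ¬ W ≤ 2 ^ j * (h * K) :=
    ⟨Nat.find hex, Nat.find_spec hex, fun j hj => Nat.find_min hex hj⟩
  have hiI : i ≤ I := by
    by_contra hlt
    exact hmin I (by omega) hW
  obtain ⟨t, ht, q⟩ := p.rounded i
  refine ⟨i, hiI, t, ?_, q, ?_⟩
  · have h1 : 2 ^ i * t ≤ 2 ^ i * (h * (K + 1)) := by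
      calc 2 ^ i * t ≤ 2 ^ i * (h * K) + h * 2 ^ i :=
            ht.trans (add_le_add hi (Nat.mul_le_mul hh (Nat.sub_le _ _)))
        _ = 2 ^ i * (h * (K + 1)) := by ring
    exact Nat.le_of_mul_le_mul_left h1 (Nat.two_pow_pos i)
  -- At scale 0 nothing is rounded, so the missing lower bound on `W` is not needed.
  · rcases i with _ | i
    · simp only [pow_zero, one_mul, Nat.sub_self, mul_zero, add_zero] at ht ⊢
      exact Nat.mul_le_mul (by omega) ht
    · have h2 : 2 ^ i * (h * K) < W := not_le.1 (hmin i (by omega))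
      have h3 : 2 ^ (i + 1) * t ≤ W + h * 2 ^ (i + 1) :=
        ht.trans (by gcongr; exact Nat.sub_le _ _)
      calc K * (2 ^ (i + 1) * t) ≤ K * (W + h * 2 ^ (i + 1)) := by gcongr
        _ = K * W + 2 * (2 ^ i * (h * K)) := by ring
        _ ≤ K * W + 2 * W := by gcongr
        _ = (K + 2) * W := by ring

end WPath

/-! ### The `k` elements of smallest key -/

open Classical in
/-- The `k` elements of `A` with the smallest keys. -/
def lightest {ι : Type*} (k : ℕ) (A : Finset ι) (key : ι → ℕ) : Finset ι :=
  A.filter fun u => (A.filter fun u' => key u' < key u).card < k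

/-- For distinct keys, the number of elements with a smaller key is injective, and on `lightest` it
takes values below `k`. -/
theorem card_lightest_le {ι : Type*} {k : ℕ} {A : Finset ι} {key : ι → ℕ}
    (hkey : Set.InjOn key A) : (lightest k A key).card ≤ k := by
  classical
  let r : ι → ℕ := fun u => (A.filter fun u' => key u' < key u).card
  have hlt : ∀ u ∈ A, ∀ v ∈ A, key u < key v → r u < r v := by
    intro u hu v _ h
    refine Finset.card_lt_card (Finset.ssubset_iff_subset_ne.2 ⟨fun x hx => ?_, fun he => ?_⟩)
    · simp only [Finset.mem_filter] at hx ⊢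
      exact ⟨hx.1, hx.2.trans h⟩
    · have : u ∈ A.filter fun u' => key u' < key u := by
        rw [he]; simp [hu, h]
      simp at this
  have := Finset.card_le_card_of_injOn (s := lightest k A key) (t := Finset.range k) r ?_ ?_
  · simpa using this
  · intro u hu
    simp only [lightest, Finset.coe_filter, Set.mem_ofPred_eq] at hu
    simpa using hu.2
  · intro u hu v hv h
    simp only [lightest, Finset.coe_filter, Set.mem_ofPred_eq] at hu hv
    rcases lt_trichotomy (key u) (key v) with h' | h' | h'
    · exact absurd h (hlt u hu.1 v hv.1 h').ne
    · exact hkey hu.1 hv.1 h'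
    · exact absurd h (hlt v hv.1 u hu.1 h').ne'

theorem exists_lighter {ι : Type*} {k : ℕ} {A : Finset ι} {key : ι → ℕ} {u : ι} (hu : u ∈ A)
    (hu' : u ∉ lightest k A key) :
    k ≤ (lightest k A key).card ∧ ∀ z ∈ lightest k A key, key z ≤ key u := by
  classical
  have hr : k ≤ (A.filter fun u' => key u' < key u).card := by
    by_contra h
    exact hu' (by simp only [lightest, Finset.mem_filter]; exact ⟨hu, by omega⟩)
  constructor
  -- Everything lighter than the lightest rejected element was accepted, and there are at least `k`
  -- such elements.
  · obtain ⟨u₀, hu₀, hmin⟩ := Finset.exists_min_image (A \ lightest k A key) key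
      ⟨u, by simp [hu, hu']⟩
    simp only [Finset.mem_sdiff] at hu₀ hmin
    have hr₀ : k ≤ (A.filter fun u' => key u' < key u₀).card := by
      by_contra h
      exact hu₀.2 (by simp only [lightest, Finset.mem_filter]; exact ⟨hu₀.1, by omega⟩)
    refine hr₀.trans (Finset.card_le_card fun z hz => ?_)
    simp only [Finset.mem_filter] at hz
    by_contra hzn
    exact absurd (hmin z ⟨hz.1, hzn⟩) (by omega)
  · intro z hz
    simp only [lightest, Finset.mem_filter] at hz
    by_contra hlt
    refine absurd (hr.trans (Finset.card_le_card fun x hx => ?_)) (not_le.2 hz.2)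
    simp only [Finset.mem_filter] at hx ⊢
    exact ⟨hx.1, by omega⟩

/-! ### Shortcuts -/

/-- The edges of `E`, and the paths of `F` as single edges. -/
def Shortcut {α : Type*} (E F : α → α → ℕ → Prop) (u v : α) (w : ℕ) : Prop :=
  1 ≤ w ∧ (E u v w ∨ ∃ h, WPath F u h v w)

open Classical in
/-- The vertices of `S` at distance at most `ρ` from `u`. -/
def distBall {α : Type*} (F : α → α → ℕ → Prop) (S : Finset α) (u : α) (ρ : ℕ) : Finset α :=
  S.filter fun z => ∃ h, ∃ W ≤ ρ, WPath F u h z W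

section Shortcut

variable {α : Type*} {E F : α → α → ℕ → Prop} {S : Finset α} {k : ℕ}

/-- If `F` contains the `k` lightest edges at every vertex, then it preserves the distances
within a ball of at most `k` vertices. -/
theorem exists_path_of_card_distBall_le (hFE : ∀ u v w, F u v w → E u v w)
    (hS : ∀ u v w, E u v w → v ∈ S)
    (hF : ∀ y y' w, E y y' w → F y y' w ∨
      ∃ Z : Finset α, k ≤ Z.card ∧ y ∉ Z ∧ ∀ z ∈ Z, ∃ w' ≤ w, F y z w')
    {u v : α} {ρ h W : ℕ} (hu : u ∈ S) (hρ : (distBall F S u ρ).card ≤ k)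
    (p : WPath E u h v W) (hW : W ≤ ρ) : ∃ h', ∃ W' ≤ W, WPath F u h' v W' := by
  classical
  induction p with
  | nil => exact ⟨0, 0, le_rfl, .nil⟩
  | @snoc h y y' W w p e ih =>
    obtain ⟨h', W', hW', q⟩ := ih (by omega)
    rcases hF y y' w e with e' | ⟨Z, hZ, hyZ, hZF⟩
    · exact ⟨_, W' + w, by omega, q.snoc e'⟩
    -- If the edge at `y` is missing from `F`, then `y` and its `k` neighbours in `Z` all lie within
    -- `W + w ≤ ρ`: one vertex too many for the ball.
    · exfalso
      have hsub : insert y Z ⊆ distBall F S u ρ := by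
        intro z hz
        simp only [distBall, Finset.mem_filter]
        rcases Finset.mem_insert.1 hz with rfl | hz
        · exact ⟨p.mem_of_edges (S := (S : Set α)) hS hu, h', W', by omega, q⟩
        · obtain ⟨w', hw', e'⟩ := hZF z hz
          exact ⟨hS _ _ _ (hFE _ _ _ e'), _, W' + w', by omega, q.snoc e'⟩
      have := Finset.card_le_card hsub
      rw [Finset.card_insert_of_notMem hyZ] at this
      omega

/-- Around each vertex of a shortest path, take the smallest `F`-ball with more than `k` vertices.
Inside the radius one shortcut suffices, so two vertices whose balls meet are at most 4 hops apart.
Going on to the last vertex whose ball meets the current one, and then one edge further, costs 5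
hops and leaves a ball disjoint from all later ones; there are at most `S.card / (k + 1)` disjoint
balls. The summand 2 covers the case in which some ball never exceeds `k` vertices. -/
theorem exists_few_hops (hpos : ∀ u v w, E u v w → 1 ≤ w) (hE : ∀ u v w, E u v w → E v u w)
    (hFE : ∀ u v w, F u v w → E u v w) (hFs : ∀ u v w, F u v w → F v u w)
    (hS : ∀ u v w, E u v w → v ∈ S) (hk : 1 ≤ k)
    (hF : ∀ y y' w, E y y' w → F y y' w ∨
      ∃ Z : Finset α, k ≤ Z.card ∧ y ∉ Z ∧ ∀ z ∈ Z, ∃ w' ≤ w, F y z w')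
    {u v : α} {h₀ W₀ : ℕ} (hu : u ∈ S) (p₀ : WPath E u h₀ v W₀) :
    ∃ h ≤ 5 * (S.card / (k + 1)) + 2, ∃ W ≤ W₀, WPath (Shortcut E F) u h v W := by
  classical
  have hex : ∃ W h, WPath E u h v W := ⟨W₀, h₀, p₀⟩
  obtain ⟨W, ⟨m, p⟩, hWW, hmin⟩ : ∃ W, (∃ m, WPath E u m v W) ∧ W ≤ W₀ ∧
      ∀ W' h', WPath E u h' v W' → W ≤ W' :=
    ⟨Nat.find hex, Nat.find_spec hex, Nat.find_min' hex ⟨_, p₀⟩,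
      fun W' h' q => Nat.find_min' hex ⟨_, q⟩⟩
  obtain ⟨x, c, hx0, hxm, hc0, hcm, hs⟩ := p.exists_sequence
  have hseg : ∀ i j, i ≤ j → j ≤ m →
      c i ≤ c j ∧ WPath E (x i) (j - i) (x j) (c j - c i) :=
    fun i j hij hj => WPath.of_sequence hs hij hj
  have hlt : ∀ i < m, c i < c (i + 1) := fun i hi => by
    obtain ⟨w, e, hw⟩ := hs i hi
    have := hpos _ _ _ e
    omega
  have hxS : ∀ i ≤ m, x i ∈ S := fun i hi =>
    (hseg 0 i (Nat.zero_le _) hi).2.mem_of_edges (S := (S : Set α)) hS (by simpa [hx0] using hu)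
  have hgeo : ∀ i j h' W', i ≤ j → j ≤ m → WPath E (x i) h' (x j) W' → c j - c i ≤ W' := by
    intro i j h' W' hij hj q
    have h1 := hseg 0 i (Nat.zero_le _) (hij.trans hj)
    have h2 := hseg j m hj le_rfl
    have h3 := (h1.2.trans q).trans h2.2
    rw [hx0, hxm] at h3
    have := hmin _ _ h3
    have := (hseg i j hij hj).1
    omega
  have hjump : ∀ i j h' W', i ≤ j → j ≤ m → W' ≤ c j - c i → WPath F (x i) h' (x j) W' →
      ∃ h ≤ 1, WPath (Shortcut E F) (x i) h (x j) (c j - c i) := by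
    intro i j h' W' hij hj hW' q
    -- The path is a geodesic of `E`, so an `F`-path that is not longer has exactly the same weight.
    obtain rfl : W' = c j - c i := le_antisymm hW' (hgeo i j h' W' hij hj (q.mono hFE))
    rcases Nat.eq_zero_or_pos (c j - c i) with h0 | h0
    · have hx : x i = x j := by
        rw [h0] at q
        exact (q.mono hFE).eq_of_weight_zero hpos
      exact ⟨0, Nat.zero_le _, by rw [h0, ← hx]; exact .nil⟩
    · exact ⟨1, le_rfl, .single ⟨h0, Or.inr ⟨_, q⟩⟩⟩
  have hforw : ∀ i j ρ, i ≤ j → j ≤ m → (distBall F S (x i) ρ).card ≤ k → c j - c i ≤ ρ →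
      ∃ h ≤ 1, WPath (Shortcut E F) (x i) h (x j) (c j - c i) := by
    intro i j ρ hij hj hρ hc
    obtain ⟨h', W', hW', q⟩ := exists_path_of_card_distBall_le hFE hS hF
      (hxS i (hij.trans hj)) hρ (hseg i j hij hj).2 hc
    exact hjump i j h' W' hij hj hW' q
  have hback : ∀ i j ρ, i ≤ j → j ≤ m → (distBall F S (x j) ρ).card ≤ k → c j - c i ≤ ρ →
      ∃ h ≤ 1, WPath (Shortcut E F) (x i) h (x j) (c j - c i) := by
    intro i j ρ hij hj hρ hc
    obtain ⟨h', W', hW', q⟩ := exists_path_of_card_distBall_le hFE hS hF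
      (hxS j hj) hρ ((hseg i j hij hj).2.symm hE) hc
    exact hjump i j h' W' hij hj hW' (q.symm hFs)
  have hstep : ∀ i < m, WPath (Shortcut E F) (x i) 1 (x (i + 1)) (c (i + 1) - c i) := by
    intro i hi
    obtain ⟨w, e, hw⟩ := hs i hi
    rw [show c (i + 1) - c i = w by omega]
    exact .single ⟨hpos _ _ _ e, Or.inl e⟩
  have hcat : ∀ {i j l h₁ h₂}, i ≤ j → j ≤ l → l ≤ m →
      WPath (Shortcut E F) (x i) h₁ (x j) (c j - c i) →
      WPath (Shortcut E F) (x j) h₂ (x l) (c l - c j) →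
      WPath (Shortcut E F) (x i) (h₁ + h₂) (x l) (c l - c i) := by
    intro i j l h₁ h₂ hij hjl hl q r
    have h1 := (hseg i j hij (hjl.trans hl)).1
    have h2 := (hseg j l hjl hl).1
    rw [show c l - c i = c j - c i + (c l - c j) by omega]
    exact q.trans r
  have hfin : ∀ {h}, WPath (Shortcut E F) (x 0) h (x m) (c m - c 0) →
      WPath (Shortcut E F) u h v W := by
    intro h q
    rwa [hx0, hxm, hcm, hc0, Nat.sub_zero] at q
  -- A vertex whose balls all stay small reaches both ends of the path by one shortcut each.
  by_cases hinf : ∃ i ≤ m, ∀ ρ, (distBall F S (x i) ρ).card ≤ k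
  · obtain ⟨i, him, hi⟩ := hinf
    obtain ⟨h₁, hh₁, q₁⟩ := hback 0 i _ (Nat.zero_le _) him (hi _) le_rfl
    obtain ⟨h₂, hh₂, q₂⟩ := hforw i m _ him le_rfl (hi _) le_rfl
    exact ⟨h₁ + h₂, by omega, W, hWW, hfin (hcat (Nat.zero_le _) him le_rfl q₁ q₂)⟩
  push Not at hinf
  have hR : ∀ i, ∃ R, i ≤ m → 1 ≤ R ∧ k < (distBall F S (x i) R).card ∧
      ∀ ρ < R, (distBall F S (x i) ρ).card ≤ k := by
    intro i
    by_cases him : i ≤ m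
    · refine ⟨Nat.find (hinf i him), fun _ => ⟨?_, Nat.find_spec (hinf i him),
        fun ρ hρ => not_lt.1 (Nat.find_min (hinf i him) hρ)⟩⟩
      by_contra h0
      have h0' : Nat.find (hinf i him) = 0 := by omega
      have h1 := Nat.find_spec (hinf i him)
      rw [h0'] at h1
      -- Weights are positive and `k ≥ 1`, so the critical radius is never 0; this guarantees
      -- progress in `hnear`.
      have : distBall F S (x i) 0 ⊆ {x i} := by
        intro z hz
        simp only [distBall, Finset.mem_filter] at hz
        obtain ⟨_, h', W', hW', q⟩ := hz
        obtain rfl : W' = 0 := by omega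
        simpa using ((q.mono hFE).eq_of_weight_zero hpos).symm
      have := Finset.card_le_card this
      simp at this
      omega
    · exact ⟨0, fun h => absurd h him⟩
  choose R hR using hR
  have hnear : ∀ i l, i ≤ l → l ≤ m →
      ¬ Disjoint (distBall F S (x i) (R i)) (distBall F S (x l) (R l)) →
      ∃ h ≤ 4, WPath (Shortcut E F) (x i) h (x l) (c l - c i) := by
    intro i l hil hlm hd
    have hRi := hR i (hil.trans hlm)
    have hRl := hR l hlm
    have hdist : c l - c i ≤ R i + R l := by
      rw [Finset.not_disjoint_iff] at hd
      obtain ⟨z, h1, h2⟩ := hd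
      simp only [distBall, Finset.mem_filter] at h1 h2
      obtain ⟨_, a₁, W₁, hW₁, q₁⟩ := h1
      obtain ⟨_, a₂, W₂, hW₂, q₂⟩ := h2
      have := hgeo i l _ _ hil hlm (((q₁.mono hFE)).trans ((q₂.mono hFE).symm hE))
      omega
    by_cases hall : c l - c i < R i
    · obtain ⟨h, hh, q⟩ := hforw i l _ hil hlm (hRi.2.2 _ hall) le_rfl
      exact ⟨h, by omega, q⟩
    have hexj : ∃ j, i ≤ j ∧ R i ≤ c j - c i := ⟨l, hil, not_lt.1 hall⟩
    -- The first vertex outside the open ball around `x i`: one shortcut reaches its predecessor and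
    -- one edge crosses. One more edge enters the range of a backward shortcut from `x l`, since the
    -- two radii together cover the distance.
    obtain ⟨j, ⟨hij, hcj⟩, hjl, hjmin⟩ : ∃ j, (i ≤ j ∧ R i ≤ c j - c i) ∧ j ≤ l ∧
        ∀ j' < j, ¬ (i ≤ j' ∧ R i ≤ c j' - c i) :=
      ⟨Nat.find hexj, Nat.find_spec hexj, Nat.find_min' hexj ⟨hil, not_lt.1 hall⟩,
        fun j' hj' => Nat.find_min hexj hj'⟩
    have hne : i ≠ j := by rintro rfl; omega
    obtain ⟨j, rfl⟩ : ∃ j', j = j' + 1 := ⟨j - 1, by omega⟩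
    have hjR : c j - c i < R i := by
      by_contra hh
      exact hjmin j (by omega) ⟨by omega, by omega⟩
    obtain ⟨h₁, hh₁, q₁⟩ := hforw i j _ (by omega) (by omega) (hRi.2.2 _ hjR) le_rfl
    have q₂ := hcat (by omega) (by omega) (by omega) q₁ (hstep j (by omega))
    rcases Nat.lt_or_ge (j + 1) l with hl | hl
    · have h3 := hlt (j + 1) (by omega)
      have h4 := (hseg (j + 1 + 1) l (by omega) hlm).1
      have h5 := (hseg i (j + 1) (by omega) (by omega)).1
      obtain ⟨h₃, hh₃, q₃⟩ := hback (j + 1 + 1) l _ (by omega) hlm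
        (hRl.2.2 (c l - c (j + 1 + 1)) (by omega)) le_rfl
      exact ⟨_, by omega, hcat (by omega) (by omega) hlm
        (hcat (by omega) (by omega) (by omega) q₂ (hstep (j + 1) (by omega))) q₃⟩
    · obtain rfl : l = j + 1 := by omega
      exact ⟨_, by omega, q₂⟩
  let U : ℕ → Finset α := fun i => (Finset.Icc i m).biUnion fun j => distBall F S (x j) (R j)
  have hmain : ∀ d i, i ≤ m → m - i ≤ d → ∃ t, t * (k + 1) ≤ (U i).card ∧
      ∃ h ≤ 5 * t, WPath (Shortcut E F) (x i) h (x m) (c m - c i) := by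
    intro d
    induction d with
    | zero =>
      intro i him hd
      obtain rfl : i = m := by omega
      exact ⟨0, by simp, 0, le_rfl, by simpa using WPath.nil⟩
    | succ d ih =>
      intro i him _
      have hRi := hR i him
      -- Maximality of `l` makes the ball around `x i` disjoint from the balls of all vertices after
      -- `l`, which lets their sizes be added.
      obtain ⟨l, hl, hlmax⟩ := Finset.exists_max_image ((Finset.Icc i m).filter fun l =>
        ¬ Disjoint (distBall F S (x i) (R i)) (distBall F S (x l) (R l))) id ⟨i, by
          simp only [Finset.mem_filter, Finset.mem_Icc, le_rfl, him, true_and, disjoint_self,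
            Finset.bot_eq_empty]
          intro h
          rw [h] at hRi
          simp at hRi⟩
      simp only [Finset.mem_filter, Finset.mem_Icc, id] at hl hlmax
      obtain ⟨h₁, hh₁, q₁⟩ := hnear i l hl.1.1 hl.1.2 hl.2
      have hBU : distBall F S (x i) (R i) ⊆ U i :=
        Finset.subset_biUnion_of_mem (fun j => distBall F S (x j) (R j)) (by simpa using him)
      rcases Nat.lt_or_ge l m with hlm | hlm
      · obtain ⟨t, ht, h₂, hh₂, q₂⟩ := ih (l + 1) (by omega) (by omega)
        have hsub : distBall F S (x i) (R i) ∪ U (l + 1) ⊆ U i := by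
          refine Finset.union_subset hBU (Finset.biUnion_subset_biUnion_of_subset_left _ ?_)
          exact Finset.Icc_subset_Icc (by omega) le_rfl
        have hdisj : Disjoint (distBall F S (x i) (R i)) (U (l + 1)) := by
          refine (Finset.disjoint_biUnion_right _ _ _).2 fun j hj => ?_
          by_contra hnd
          rw [Finset.mem_Icc] at hj
          have := hlmax j ⟨⟨by omega, hj.2⟩, hnd⟩
          omega
        have hcard := Finset.card_le_card hsub
        rw [Finset.card_union_of_disjoint hdisj] at hcard
        refine ⟨t + 1, by rw [add_mul]; omega, _, ?_, hcat (j := l + 1) (by omega) hlm le_rfl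
          (hcat hl.1.1 (by omega) hlm q₁ (hstep l hlm)) q₂⟩
        omega
      · obtain rfl : l = m := by omega
        refine ⟨1, ?_, h₁, by omega, q₁⟩
        have := Finset.card_le_card hBU
        omega
  obtain ⟨t, ht, h, hh, q⟩ := hmain m 0 (Nat.zero_le _) (by omega)
  have hUS : (U 0).card ≤ S.card := Finset.card_le_card
    (Finset.biUnion_subset.2 fun j _ => Finset.filter_subset _ _)
  have htS : t ≤ S.card / (k + 1) :=
    (Nat.le_div_iff_mul_le (Nat.succ_pos k)).2 (ht.trans hUS)
  exact ⟨h, by omega, W, hWW, hfin q⟩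

end Shortcut

/-! ### Pipelined detection of tokens

In one phase of the algorithm, tokens (numbers less than `Q`) travel through the network. A node
learns pairs `(θ, W)`: the token `θ` has reached it with key `W`. In round `r` a node sends the
pair for which the key plus the rank among the pairs known to it equals `r`. -/

/-- The part of one node in a phase: `init` are its initial tokens (with key `0`), `link i` is
added to the keys that come from the neighbour `i`, and `relay θ W θ' W'` says that `(θ', W')` can
be deduced locally from `(θ, W)`. -/
structure PhaseSpec where
  init : Set ℕ
  link : ℕ → ℕ
  relay : ℕ → ℕ → ℕ → ℕ → Prop

/-- A set of pairs (token, key). -/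
abbrev Table := Set (ℕ × ℕ)

open Classical in
/-- The number of tokens that have in `T` a pair not after `(θ, W)`; pairs are ordered by their
keys, then by their tokens. -/
def tokenRank (Q : ℕ) (T : Table) (θ W : ℕ) : ℕ :=
  ((Finset.range Q).filter fun θ' => ∃ W', (θ', W') ∈ T ∧ (W' < W ∨ W' = W ∧ θ' ≤ θ)).card

/-- `(θ, W)` is the pair to be sent in round `r`. -/
def Due (Q : ℕ) (T : Table) (r θ W : ℕ) : Prop :=
  θ < Q ∧ (θ, W) ∈ T ∧ (∀ W', (θ, W') ∈ T → W ≤ W') ∧ W + tokenRank Q T θ W = r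

/-- The later pair counts its own token, which the earlier one cannot count because `W₂` is the
least key of that token. -/
theorem tokenRank_lt {Q : ℕ} {T : Table} {θ₁ W₁ θ₂ W₂ : ℕ} (h₂ : θ₂ < Q) (m₂ : (θ₂, W₂) ∈ T)
    (hmin : ∀ W', (θ₂, W') ∈ T → W₂ ≤ W') (h : W₁ < W₂ ∨ W₁ = W₂ ∧ θ₁ < θ₂) :
    tokenRank Q T θ₁ W₁ < tokenRank Q T θ₂ W₂ := by
  classical
  refine Finset.card_lt_card (Finset.ssubset_iff_of_subset ?_ |>.2 ⟨θ₂, ?_, ?_⟩)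
  · intro θ hθ
    simp only [Finset.mem_filter] at hθ ⊢
    obtain ⟨hQ, W', hm, hW'⟩ := hθ
    exact ⟨hQ, W', hm, by omega⟩
  · simp only [Finset.mem_filter, Finset.mem_range]
    exact ⟨h₂, W₂, m₂, by omega⟩
  · simp only [Finset.mem_filter, Finset.mem_range, not_and, not_exists]
    intro _ W' hm
    have := hmin W' hm
    omega

/-- Along the order of the pairs the rank increases strictly and the key weakly, so their sum
determines the pair. Hence one message per round is enough. -/
theorem Due.unique {Q : ℕ} {T : Table} {r θ₁ W₁ θ₂ W₂ : ℕ} (h₁ : Due Q T r θ₁ W₁)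
    (h₂ : Due Q T r θ₂ W₂) : θ₁ = θ₂ ∧ W₁ = W₂ := by
  obtain ⟨q₁, m₁, i₁, r₁⟩ := h₁
  obtain ⟨q₂, m₂, i₂, r₂⟩ := h₂
  rcases lt_trichotomy W₁ W₂ with h | h | h
  · have := tokenRank_lt q₂ m₂ i₂ (θ₁ := θ₁) (Or.inl h); omega
  · rcases lt_trichotomy θ₁ θ₂ with h' | h' | h'
    · have := tokenRank_lt q₂ m₂ i₂ (θ₁ := θ₁) (Or.inr ⟨h, h'⟩); omega
    · exact ⟨h', h⟩
    · have := tokenRank_lt q₁ m₁ i₁ (θ₁ := θ₂) (Or.inr ⟨h.symm, h'⟩); omega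
  · have := tokenRank_lt q₁ m₁ i₁ (θ₁ := θ₂) (Or.inl h); omega

theorem one_le_tokenRank {Q : ℕ} {T : Table} {θ W : ℕ} (h : θ < Q) (m : (θ, W) ∈ T) :
    1 ≤ tokenRank Q T θ W := by
  classical
  refine Finset.card_pos.2 ⟨θ, ?_⟩
  simp only [Finset.mem_filter, Finset.mem_range]
  exact ⟨h, W, m, by omega⟩

open Classical in
/-- The message sent in round `r` by a node with table `T`; the pair `(θ, W)` is coded as
`W * Q + θ`. -/
def tokenMessage (B Q : ℕ) (T : Table) (r : ℕ) : Option (BitVec B) :=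
  if h : ∃ m : BitVec B, Due Q T r (m.toNat % Q) (m.toNat / Q) then some h.choose else none

theorem due_of_tokenMessage {B Q : ℕ} {T : Table} {r : ℕ} {m : BitVec B}
    (h : tokenMessage B Q T r = some m) : Due Q T r (m.toNat % Q) (m.toNat / Q) := by
  unfold tokenMessage at h
  split at h
  · next hex => obtain rfl := Option.some.inj h; exact hex.choose_spec
  · simp at h

theorem tokenMessage_of_due {B Q : ℕ} {T : Table} {r θ W : ℕ} (h : Due Q T r θ W)
    (hB : (W + 1) * Q ≤ 2 ^ B) :
    ∃ m : BitVec B, tokenMessage B Q T r = some m ∧ m.toNat % Q = θ ∧ m.toNat / Q = W := by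
  have hQ := h.1
  have hex : ∃ m : BitVec B, Due Q T r (m.toNat % Q) (m.toNat / Q) := by
    refine ⟨BitVec.ofNat B (W * Q + θ), ?_⟩
    have hlt : W * Q + θ < 2 ^ B := by rw [add_mul] at hB; omega
    rw [BitVec.toNat_ofNat, Nat.mod_eq_of_lt hlt, Nat.mul_comm W Q, Nat.mul_add_mod,
      Nat.mod_eq_of_lt hQ, Nat.mul_add_div (by omega), Nat.div_eq_of_lt hQ, Nat.add_zero]
    exact h
  have hu := hex.choose_spec.unique h
  exact ⟨hex.choose, by unfold tokenMessage; rw [dif_pos hex], hu.1, hu.2⟩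

/-- The table after a round with incoming messages `box`. -/
def PhaseSpec.absorb {B : ℕ} (σ : PhaseSpec) (Q : ℕ) (T : Table) (box : ℕ → Option (BitVec B)) :
    Table :=
  {p | p ∈ T ∨ (∃ i m, box i = some m ∧ p = (m.toNat % Q, m.toNat / Q + σ.link i)) ∨
    ∃ q ∈ T, σ.relay q.1 q.2 p.1 p.2}

/-- The table at the beginning of a phase. -/
def PhaseSpec.table₀ (σ : PhaseSpec) : Table := {p | p.1 ∈ σ.init ∧ p.2 = 0}

/-! ### Soundness and speed of the pipelining -/

namespace WeightedNetwork

variable {n a : ℕ} (N : WeightedNetwork n a)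

open Classical in
/-- The messages that arrive at `v` in round `r` of a phase. -/
def heard (B Q : ℕ) (T : N.V → Table) (r : ℕ) (v : N.V) (i : ℕ) : Option (BitVec B) :=
  if h : i ∈ N.V then
    if N.graph.Adj ⟨i, h⟩ v then tokenMessage B Q (T ⟨i, h⟩) r else none
  else none

/-- The tables of all nodes after `r` rounds of a phase. -/
def tables (B Q : ℕ) (σ : N.V → PhaseSpec) : ℕ → N.V → Table
  | 0 => fun v => (σ v).table₀
  | r + 1 => fun v => (σ v).absorb Q (tables B Q σ r v) (N.heard B Q (tables B Q σ r) r v)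

/-- `Reach σ v θ W`: the token `θ` can reach `v` with key `W`. -/
inductive Reach (σ : N.V → PhaseSpec) : N.V → ℕ → ℕ → Prop
  | init {v : N.V} {θ : ℕ} : θ ∈ (σ v).init → Reach σ v θ 0
  | hop {u v : N.V} {θ W : ℕ} :
      N.graph.Adj u v → Reach σ u θ W → Reach σ v θ (W + (σ v).link u)
  | relay {v : N.V} {θ W θ' W' : ℕ} :
      Reach σ v θ W → (σ v).relay θ W θ' W' → Reach σ v θ' W'

variable {N} {B Q : ℕ} {σ : N.V → PhaseSpec}

theorem reach_of_mem_tables {r : ℕ} {v : N.V} {θ W : ℕ} (h : (θ, W) ∈ N.tables B Q σ r v) :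
    N.Reach σ v θ W := by
  induction r generalizing v θ W with
  | zero => obtain ⟨h1, rfl⟩ := h; exact .init h1
  | succ r ih =>
    rcases h with h | ⟨i, m, hm, hp⟩ | ⟨⟨θ', W'⟩, h, hr⟩
    · exact ih h
    · unfold heard at hm
      split_ifs at hm with hi hadj
      · obtain ⟨rfl, rfl⟩ := Prod.mk.inj hp
        exact .hop (u := ⟨i, hi⟩) hadj (ih (due_of_tokenMessage hm).2.1)
    · exact .relay (ih h) hr

theorem tables_mono {r r' : ℕ} (h : r ≤ r') (v : N.V) :
    N.tables B Q σ r v ⊆ N.tables B Q σ r' v := by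
  induction r', h using Nat.le_induction with
  | base => exact subset_rfl
  | succ r' _ ih => exact ih.trans fun p hp => Or.inl hp

/-- All pairs that can reach `v`. -/
def reachTable (σ : N.V → PhaseSpec) (v : N.V) : Table := {p | N.Reach σ v p.1 p.2}

/-- A hop adds the same amount to all keys, so every token counted at `u` is also counted at `v`. -/
theorem tokenRank_hop_le {u v : N.V} (h : N.graph.Adj u v) (θ W : ℕ) :
    tokenRank Q (N.reachTable σ u) θ W ≤
      tokenRank Q (N.reachTable σ v) θ (W + (σ v).link u) := by
  classical
  refine Finset.card_le_card fun θ' hθ => ?_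
  simp only [Finset.mem_filter] at hθ ⊢
  obtain ⟨hQ, W', hr, hW'⟩ := hθ
  exact ⟨hQ, _, Reach.hop h hr, by omega⟩

variable (hlink : ∀ u v : N.V, N.graph.Adj u v → 1 ≤ (σ v).link u)
  (hrelay : ∀ v θ W θ' W', (σ v).relay θ W θ' W' → W < W' ∧
    ∀ W₀ ≤ W, ∃ W₁ ≤ W', (σ v).relay θ W₀ θ' W₁)
  (hQ : ∀ v θ W, N.Reach σ v θ W → θ < Q)

include hlink hrelay hQ

/-- A token with least key `W` is known by the round `W` plus its final rank. Over a hop the rank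
does not decrease and the key grows by at least 1, which leaves a round for the message. A local
deduction increases both key and rank, which leaves a round for it too. -/
theorem mem_tables_of_rank_le {τ : ℕ} (hB : τ * Q ≤ 2 ^ B) {r : ℕ} (hr : r ≤ τ) {v : N.V}
    {θ W : ℕ} (h : N.Reach σ v θ W) (hmin : ∀ W', N.Reach σ v θ W' → W ≤ W')
    (hrank : W + tokenRank Q (N.reachTable σ v) θ W ≤ r) : (θ, W) ∈ N.tables B Q σ r v := by
  classical
  induction r using Nat.strong_induction_on generalizing v θ W with
  | _ r ih =>
    rcases Nat.eq_zero_or_pos r with rfl | hr0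
    · have := one_le_tokenRank (T := N.reachTable σ v) (hQ _ _ _ h) h
      omega
    obtain ⟨r, rfl⟩ : ∃ r', r = r' + 1 := ⟨r - 1, by omega⟩
    cases h with
    | init h => exact tables_mono (Nat.zero_le _) v ⟨h, rfl⟩
    | @hop u _ _ W hadj hu =>
      have hl := hlink _ _ hadj
      have hmin' : ∀ W', N.Reach σ u θ W' → W ≤ W' := fun W' hW' => by
        have := hmin _ (.hop hadj hW'); omega
      have hrk := tokenRank_hop_le (Q := Q) (σ := σ) hadj θ W
      set r₀ := W + tokenRank Q (N.reachTable σ u) θ W with hr₀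
      have hmem := ih r₀ (by omega) (by omega) hu hmin' hr₀.ge
      have hdue : Due Q (N.tables B Q σ r₀ u) r₀ θ W := by
        refine ⟨hQ _ _ _ hu, hmem, fun W' hW' => hmin' W' (reach_of_mem_tables hW'), ?_⟩
        -- By induction all tokens that precede `(θ, W)` are already known at `u`, so the current
        -- rank is the final one and the token is sent exactly in round `r₀`.
        have : tokenRank Q (N.tables B Q σ r₀ u) θ W =
            tokenRank Q (N.reachTable σ u) θ W := by
          unfold tokenRank
          congr 1
          ext θ'
          simp only [Finset.mem_filter, Finset.mem_range, and_congr_right_iff]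
          intro _
          constructor
          · rintro ⟨W', hm, hW'⟩
            exact ⟨W', reach_of_mem_tables hm, hW'⟩
          · rintro ⟨W', hm, hW'⟩
            have hexm : ∃ W₀, N.Reach σ u θ' W₀ := ⟨W', hm⟩
            have hW₀ := Nat.find_spec hexm
            have hle : Nat.find hexm ≤ W' := Nat.find_min' hexm hm
            have hmin₀ : ∀ W'', N.Reach σ u θ' W'' → Nat.find hexm ≤ W'' :=
              fun W'' h'' => Nat.find_min' hexm h''
            refine ⟨Nat.find hexm, ih r₀ (by omega) (by omega) hW₀ hmin₀ ?_, by omega⟩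
            rw [hr₀]
            have : tokenRank Q (N.reachTable σ u) θ' (Nat.find hexm) ≤
                tokenRank Q (N.reachTable σ u) θ W := by
              refine Finset.card_le_card fun θ₁ h₁ => ?_
              simp only [Finset.mem_filter] at h₁ ⊢
              obtain ⟨hq, W₁, hm₁, h₁⟩ := h₁
              exact ⟨hq, W₁, hm₁, by omega⟩
            omega
        rw [this]
      have hB' : (W + 1) * Q ≤ 2 ^ B := (Nat.mul_le_mul_right Q (by omega)).trans hB
      obtain ⟨m, hm, hm1, hm2⟩ := tokenMessage_of_due hdue hB'
      refine tables_mono (show r₀ + 1 ≤ r + 1 by omega) v (Or.inr (Or.inl ⟨u, m, ?_, ?_⟩))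
      · unfold heard
        rw [dif_pos u.2, if_pos hadj]
        exact hm
      · rw [hm1, hm2]
    | @relay _ θ₀ W₀ _ _ h₀ hrel =>
      have hexm : ∃ W₁, N.Reach σ v θ₀ W₁ := ⟨W₀, h₀⟩
      have hW₁ := Nat.find_spec hexm
      have hmin₁ : ∀ W'', N.Reach σ v θ₀ W'' → Nat.find hexm ≤ W'' :=
        fun W'' h'' => Nat.find_min' hexm h''
      -- Monotonicity of `relay` permits starting from the least key of `θ₀`; minimality of `W`
      -- excludes any gain from this.
      obtain ⟨W₂, hW₂, hrel₂⟩ := (hrelay _ _ _ _ _ hrel).2 _ (hmin₁ _ h₀)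
      obtain rfl : W₂ = W := le_antisymm hW₂ (hmin _ (.relay hW₁ hrel₂))
      have hlt := (hrelay _ _ _ _ _ hrel₂).1
      have hrk := tokenRank_lt (T := N.reachTable σ v) (θ₁ := θ₀) (W₁ := Nat.find hexm)
        (hQ _ _ _ (.relay h₀ hrel)) (Reach.relay h₀ hrel) hmin (Or.inl hlt)
      exact Or.inr (Or.inr ⟨(θ₀, Nat.find hexm),
        ih r (by omega) (by omega) hW₁ hmin₁ (by omega), hrel₂⟩)

/-- If there are at most `m` tokens, then everything with key at most `τ - m` is found within `τ`
rounds. -/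
theorem exists_mem_tables {τ m : ℕ} (hB : τ * Q ≤ 2 ^ B) {Θ : Finset ℕ}
    (hΘ : ∀ v θ W, N.Reach σ v θ W → θ ∈ Θ) (hm : Θ.card ≤ m) {v : N.V} {θ W : ℕ}
    (h : N.Reach σ v θ W) (hW : W + m ≤ τ) : ∃ W' ≤ W, (θ, W') ∈ N.tables B Q σ τ v := by
  classical
  have hexm : ∃ W₁, N.Reach σ v θ W₁ := ⟨W, h⟩
  have hle : Nat.find hexm ≤ W := Nat.find_min' hexm h
  refine ⟨Nat.find hexm, hle, mem_tables_of_rank_le hlink hrelay hQ hB le_rfl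
    (Nat.find_spec hexm) (fun W' h' => Nat.find_min' hexm h') ?_⟩
  have : tokenRank Q (N.reachTable σ v) θ (Nat.find hexm) ≤ Θ.card := by
    refine Finset.card_le_card fun θ' h' => ?_
    simp only [Finset.mem_filter] at h'
    obtain ⟨_, W', h', _⟩ := h'
    exact hΘ _ _ _ h'
  omega

end WeightedNetwork

/-! ### Algorithms that consist of phases of equal length -/

/-- The state of a node: its input, its random bits, the final tables of the completed phases, the
number of completed rounds of the current phase, and the current table. -/
structure PhaseState (R : ℕ) where
  input : LocalInput
  bits : Fin R → Bool
  past : List Table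
  clock : ℕ
  table : Table

/-- The algorithm with `P` phases of `τ` rounds each. -/
def phasedAlgorithm (B R Q P : ℕ) (τ : LocalInput → ℕ)
    (spec : LocalInput → (Fin R → Bool) → List Table → PhaseSpec)
    (out : LocalInput → (Fin R → Bool) → List Table → ℚ) : CongestAlgorithm B R where
  State := PhaseState R
  start inp bits := .running ⟨inp, bits, [], 0, (spec inp bits []).table₀⟩
  send q _ := tokenMessage B Q q.table q.clock
  step q box :=
    let T := (spec q.input q.bits q.past).absorb Q q.table box
    if q.clock + 1 < τ q.input then .running ⟨q.input, q.bits, q.past, q.clock + 1, T⟩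
    else if q.past.length + 1 < P then
      .running ⟨q.input, q.bits, q.past ++ [T], 0,
        (spec q.input q.bits (q.past ++ [T])).table₀⟩
    else .halted (out q.input q.bits (q.past ++ [T]))

namespace WeightedNetwork

variable {n a : ℕ} (N : WeightedNetwork n a)

/-- The final tables of the first `p` phases at every node. -/
def history (B Q τ : ℕ) (spec : N.V → List Table → PhaseSpec) : ℕ → N.V → List Table
  | 0 => fun _ => []
  | p + 1 => fun v => history B Q τ spec p v ++
      [N.tables B Q (fun u => spec u (history B Q τ spec p u)) τ v]

variable {N} {B Q τ : ℕ} {spec : N.V → List Table → PhaseSpec}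

theorem length_history (p : ℕ) (v : N.V) : (N.history B Q τ spec p v).length = p := by
  induction p with
  | zero => rfl
  | succ p ih => simp [history, ih]

theorem history_getD {i p : ℕ} (h : i < p) (v : N.V) :
    (N.history B Q τ spec p v).getD i ∅ =
      N.tables B Q (fun u => spec u (N.history B Q τ spec i u)) τ v := by
  induction p with
  | zero => omega
  | succ p ih =>
    rcases Nat.lt_succ_iff_lt_or_eq.1 h with h | rfl
    · rw [history, List.getD_append _ _ _ _ (by rwa [length_history]), ih h]
    · rw [history, List.getD_append_right _ _ _ _ (length_history i v).le]
      simp [length_history]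

end WeightedNetwork

section Run

open CongestAlgorithm

variable {n a B R Q P : ℕ} {N : WeightedNetwork n a} {τ : LocalInput → ℕ}
  {spec : LocalInput → (Fin R → Bool) → List Table → PhaseSpec}
  {out : LocalInput → (Fin R → Bool) → List Table → ℚ}
  {s : N.V} {diamEst : ℕ} {ω : N.V → Fin R → Bool}

theorem run_phasedAlgorithm_succ {T r : ℕ} {L : N.V → List Table} {t : N.V → Table}
    (h : ∀ v, (phasedAlgorithm B R Q P τ spec out).run N s diamEst ω T v =
      .running ⟨localInput N s diamEst v, ω v, L v, r, t v⟩) (v : N.V) :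
    (phasedAlgorithm B R Q P τ spec out).run N s diamEst ω (T + 1) v =
      (phasedAlgorithm B R Q P τ spec out).step
        ⟨localInput N s diamEst v, ω v, L v, r, t v⟩ (N.heard B Q t r v) := by
  have hbox : (phasedAlgorithm B R Q P τ spec out).inbox N
      ((phasedAlgorithm B R Q P τ spec out).run N s diamEst ω T) v = N.heard B Q t r v := by
    funext i
    unfold inbox WeightedNetwork.heard
    split_ifs with h1 h2
    · rw [h ⟨i, h1⟩]; rfl
    · rfl
    · rfl
  show CongestAlgorithm.round _ _ _ v = _
  unfold CongestAlgorithm.round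
  rw [hbox, h v]

variable {τ₀ : ℕ} (hτ : ∀ v, τ (localInput N s diamEst v) = τ₀) (hτ₀ : 1 ≤ τ₀)

include hτ hτ₀

theorem run_phasedAlgorithm {p r : ℕ} (hp : p < P) (hr : r < τ₀) (v : N.V) :
    (phasedAlgorithm B R Q P τ spec out).run N s diamEst ω (p * τ₀ + r) v =
      .running ⟨localInput N s diamEst v, ω v,
        N.history B Q τ₀ (fun u => spec (localInput N s diamEst u) (ω u)) p v, r,
        N.tables B Q (fun u => spec (localInput N s diamEst u) (ω u)
          (N.history B Q τ₀ (fun u => spec (localInput N s diamEst u) (ω u)) p u)) r v⟩ := by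
  induction p generalizing r v with
  | zero =>
    induction r generalizing v with
    | zero => simp only [zero_mul, add_zero]; rfl
    | succ r ih =>
      rw [← add_assoc, run_phasedAlgorithm_succ fun v => ih (by omega) v]
      simp only [phasedAlgorithm, hτ, if_pos hr]
      rfl
  | succ p ihp =>
    induction r generalizing v with
    | zero =>
      have h := fun v => ihp (r := τ₀ - 1) (by omega) (by omega) v
      -- The step that ends a phase also initialises the next one, so no round lies between them.
      rw [show (p + 1) * τ₀ + 0 = (p * τ₀ + (τ₀ - 1)) + 1 by rw [add_mul]; omega,
        run_phasedAlgorithm_succ h]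
      simp only [phasedAlgorithm, hτ, WeightedNetwork.length_history, hp, if_true]
      rw [if_neg (by omega)]
      obtain ⟨k, rfl⟩ : ∃ k, τ₀ = k + 1 := ⟨τ₀ - 1, by omega⟩
      rfl
    | succ r ih =>
      rw [← add_assoc, run_phasedAlgorithm_succ fun v => ih (by omega) v]
      simp only [phasedAlgorithm, hτ, if_pos hr]
      rfl

theorem run_phasedAlgorithm_end (hP : 1 ≤ P) (v : N.V) :
    (phasedAlgorithm B R Q P τ spec out).run N s diamEst ω (P * τ₀) v =
      .halted (out (localInput N s diamEst v) (ω v)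
        (N.history B Q τ₀ (fun u => spec (localInput N s diamEst u) (ω u)) P v)) := by
  obtain ⟨p, rfl⟩ : ∃ p, P = p + 1 := ⟨P - 1, by omega⟩
  obtain ⟨k, rfl⟩ : ∃ k, τ₀ = k + 1 := ⟨τ₀ - 1, by omega⟩
  have h := fun v => run_phasedAlgorithm (B := B) (Q := Q) (spec := spec) (out := out) (ω := ω)
    hτ hτ₀ (P := p + 1) (p := p) (r := k) (by omega) (by omega) v
  rw [show (p + 1) * (k + 1) = (p * (k + 1) + k) + 1 by ring,
    run_phasedAlgorithm_succ h]
  simp only [phasedAlgorithm, hτ, WeightedNetwork.length_history, lt_irrefl, if_false]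
  rfl

end Run

/-! ### Distances in the network -/

namespace WeightedNetwork

variable {n a : ℕ} (N : WeightedNetwork n a)

/-- The weighted edges of the network. -/
def edge (u v : N.V) (w : ℕ) : Prop := N.graph.Adj u v ∧ w = N.weight s(u, v)

variable {N}

theorem edge_symm (u v : N.V) (w : ℕ) (h : N.edge u v w) : N.edge v u w :=
  ⟨h.1.symm, by rw [h.2, Sym2.eq_swap]⟩

theorem edge_pos (u v : N.V) (w : ℕ) (h : N.edge u v w) : 1 ≤ w :=
  h.2 ▸ (Finset.mem_Icc.1 (N.weight_range _ h.1)).1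

theorem edge_le (u v : N.V) (w : ℕ) (h : N.edge u v w) : w ≤ n ^ a :=
  h.2 ▸ (Finset.mem_Icc.1 (N.weight_range _ h.1)).2

theorem wpath_of_walk {u v : N.V} (p : N.graph.Walk u v) :
    WPath N.edge u p.length v (N.pathWeight p) := by
  induction p with
  | nil => exact .nil
  | cons h p ih => simpa [pathWeight] using WPath.cons (E := N.edge) ⟨h, rfl⟩ ih

theorem walk_of_wpath {u v : N.V} {h W : ℕ} (p : WPath N.edge u h v W) :
    ∃ q : N.graph.Walk u v, N.pathWeight q = W := by
  induction p with
  | nil => exact ⟨.nil, rfl⟩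
  | snoc _ e ih =>
    obtain ⟨q, hq⟩ := ih
    exact ⟨q.concat e.1, by simp [pathWeight, SimpleGraph.Walk.edges_concat, ← hq, e.2]⟩

theorem wpath_weight_le {u v : N.V} {h W : ℕ} (p : WPath N.edge u h v W) : W ≤ h * n ^ a := by
  induction p with
  | nil => simp
  | snoc _ e ih => have := edge_le _ _ _ e; rw [add_mul]; omega

theorem wdist_le {u v : N.V} {h W : ℕ} (p : WPath N.edge u h v W) : N.wdist u v ≤ W := by
  obtain ⟨q, rfl⟩ := walk_of_wpath p
  exact ciInf_le (OrderBot.bddBelow _) q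

theorem exists_shortest (u v : N.V) : ∃ h, WPath N.edge u h v (N.wdist u v) := by
  have : Nonempty (N.graph.Walk u v) := N.connected.preconnected u v
  obtain ⟨q, hq⟩ := Nat.sInf_mem (Set.range_nonempty fun p : N.graph.Walk u v => N.pathWeight p)
  exact ⟨q.length, by rw [wdist, iInf, ← hq]; exact wpath_of_walk q⟩

theorem wdist_triangle (u v x : N.V) : N.wdist u x ≤ N.wdist u v + N.wdist v x := by
  obtain ⟨_, p⟩ := exists_shortest u v
  obtain ⟨_, q⟩ := exists_shortest v x
  exact wdist_le (p.trans q)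

theorem wdist_self (u : N.V) : N.wdist u u = 0 :=
  Nat.le_zero.1 (wdist_le (.nil : WPath N.edge u 0 u 0))

theorem eq_of_wdist_eq_zero {u v : N.V} (h : N.wdist u v = 0) : u = v := by
  obtain ⟨_, p⟩ := exists_shortest u v
  rw [h] at p
  exact p.eq_of_weight_zero edge_pos

theorem wdist_le_card_mul (u v : N.V) : N.wdist u v ≤ n * n ^ a := by
  classical
  obtain ⟨p⟩ := N.connected.preconnected u v
  have hp := (SimpleGraph.Walk.bypass_isPath p).length_lt
  have := wpath_of_walk p.bypass
  refine (wdist_le this).trans ((wpath_weight_le this).trans (Nat.mul_le_mul_right _ ?_))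
  rw [Fintype.card_coe, N.card_V] at hp
  exact hp.le

theorem dist_le_hopDiam (u v : N.V) : N.graph.dist u v ≤ N.hopDiam := by
  have : Nonempty N.V := ⟨u⟩
  exact SimpleGraph.dist_le_diam (SimpleGraph.connected_iff_ediam_ne_top.1 N.connected)

/-- With unit links every token spreads over the network at the cost of the diameter. -/
theorem Reach.spread {σ : N.V → PhaseSpec} (hσ : ∀ u v : N.V, N.graph.Adj u v → (σ v).link u = 1)
    {u : N.V} {θ W : ℕ} (h : N.Reach σ u θ W) (v : N.V) :
    ∃ W' ≤ W + N.hopDiam, N.Reach σ v θ W' := by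
  have key : ∀ {u v : N.V} (p : N.graph.Walk u v) {W : ℕ}, N.Reach σ u θ W →
      N.Reach σ v θ (W + p.length) := by
    intro u v p
    induction p with
    | nil => exact fun h => h
    | cons e p ih =>
      intro W h
      have h1 := Reach.hop e h
      rw [hσ _ _ e] at h1
      simpa only [SimpleGraph.Walk.length_cons, add_assoc, add_comm 1] using ih h1
  obtain ⟨p, hp⟩ := N.connected.exists_walk_length_eq_dist u v
  have := dist_le_hopDiam u v
  exact ⟨_, by omega, key p h⟩

end WeightedNetwork

/-! ### The algorithm for shortest paths -/

/-- The parameters of the algorithm: the number `I + 1` of scales, the threshold `L` for the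
rounded distances to sampled nodes, a strict upper bound `Z` for the IDs, the number `k` of edges
published by every sampled node, the stretch `D` of the overlay edges, and the number `q` of coin
tosses used for sampling. -/
structure SSSPParams where
  I : ℕ
  L : ℕ
  Z : ℕ
  k : ℕ
  D : ℕ
  q : ℕ

namespace SSSPParams

variable (P : SSSPParams) {R : ℕ} (inp : LocalInput) (bits : Fin R → Bool) (past : List Table)

/-- The node is sampled. -/
def Sampled : Prop := inp.self = inp.source ∨ ∀ i : Fin R, (i : ℕ) < P.q → bits i = true

/-- The code of an overlay edge of weight `x` between `u` and `v`. -/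
def code (v u x : ℕ) : ℕ := v + P.Z * (u + P.Z * x)

/-- The estimates for the distance from `u` that a node has found. -/
def estimates (u : ℕ) : Set ℕ :=
  {x | ∃ i ≤ P.I, ∃ t ≤ P.L, (u, t) ∈ past.getD i ∅ ∧ x = 2 ^ i * t}

open Classical in
/-- The sampled nodes for which the node has found an estimate. -/
def candidates : Finset ℕ :=
  (Finset.range P.Z).filter fun u => u ≠ inp.self ∧ (P.estimates past u).Nonempty

/-- The other ends of the edges that a sampled node publishes. -/
def published : Finset ℕ :=
  lightest P.k (P.candidates inp past) fun u => sInf (P.estimates past u) * P.Z + u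

/-- The published edges, as known to a node. -/
def publicEdge (v u x : ℕ) : Prop :=
  v < P.Z ∧ u < P.Z ∧ ∃ W, (P.code v u x, W) ∈ past.getD (P.I + 1) ∅ ∨
    (P.code u v x, W) ∈ past.getD (P.I + 1) ∅

/-- Detection of the sampled nodes with weights divided by `2 ^ i`. -/
def scaleSpec (i : ℕ) : PhaseSpec where
  init := {θ | P.Sampled inp bits ∧ θ = inp.self}
  link := fun j => ceilShift i ((inp.nbr j).getD 0)
  relay := fun _ _ _ _ => False

/-- Broadcast of the published edges. -/
def publishSpec : PhaseSpec where
  init := {θ | P.Sampled inp bits ∧ ∃ u ∈ P.published inp past,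
    θ = P.code inp.self u (sInf (P.estimates past u))}
  link := fun _ => 1
  relay := fun _ _ _ _ => False

/-- Shortest paths on the overlay with weights divided by `2 ^ j`. -/
def overlaySpec (j : ℕ) : PhaseSpec where
  init := {θ | θ = inp.self ∧ inp.self = inp.source}
  link := fun _ => 1
  relay := fun θ W θ' W' => P.Sampled inp bits ∧ θ' = inp.self ∧ ∃ x, 1 ≤ x ∧
    ((∃ i ≤ P.I, ∃ t, (θ, t) ∈ past.getD i ∅ ∧ x = 2 ^ i * t) ∨
      ∃ h, WPath (P.publicEdge past) θ h inp.self x) ∧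
    W' = P.D * (W / P.D + ceilShift j x)

/-- The part of a node in the phase after the phases with final tables `past`. -/
def spec : PhaseSpec :=
  if past.length ≤ P.I then P.scaleSpec inp bits past.length
  else if past.length = P.I + 1 then P.publishSpec inp bits past
  else P.overlaySpec inp bits past (past.length - (P.I + 2))

/-- The possible outputs. -/
def outputs : Set ℕ :=
  {x | ∃ i ≤ P.I, ∃ j ≤ P.I, ∃ u t W, (u, t) ∈ past.getD i ∅ ∧
    (u, W) ∈ past.getD (P.I + 2 + j) ∅ ∧ x = 2 ^ j * (W / P.D) + 2 ^ i * t}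

end SSSPParams

/-! ### Correctness of the algorithm for a good sample -/

namespace SSSPParams

/-- The parameters fit the network `N`, the message size `B`, the number `Q` of tokens, the phase
length `τ`, the hop length `h`, the precision `K` and the bound `M` on the sample size. -/
structure Fits {n a : ℕ} (P : SSSPParams) (N : WeightedNetwork n a) (B Q τ h K M : ℕ) :
    Prop where
  id_lt : ∀ v : N.V, (v : ℕ) < P.Z
  code_le : P.Z * (P.Z * (2 ^ P.I * P.L + 1)) ≤ Q
  size : τ * Q ≤ 2 ^ B
  one_le_k : 1 ≤ P.k
  one_le_K : 1 ≤ K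
  L_eq : P.L = h * (K + 1)
  diam_lt : N.hopDiam < P.D
  scale_le : 3 * (n * n ^ a) ≤ 2 ^ P.I
  time_scale : P.L + M ≤ τ
  time_publish : N.hopDiam + M * P.k ≤ τ
  time_overlay : P.D * ((5 * (M / (P.k + 1)) + 2) * (K + 1)) + N.hopDiam + M ≤ τ

/-- The IDs `v` and `u` are the two lowest digits in base `P.Z`. -/
theorem code_inj {P : SSSPParams} {v u x v' u' x' : ℕ} (hv : v < P.Z) (hv' : v' < P.Z)
    (hu : u < P.Z) (hu' : u' < P.Z) (h : P.code v u x = P.code v' u' x') :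
    v = v' ∧ u = u' ∧ x = x' := by
  have key : ∀ {Z a b a' b' : ℕ}, a < Z → a' < Z → a + Z * b = a' + Z * b' → a = a' ∧ b = b' := by
    intro Z a b a' b' ha ha' h
    have h1 := congrArg (· % Z) h
    have h2 := congrArg (· / Z) h
    simp only [Nat.add_mul_mod_self_left, Nat.mod_eq_of_lt ha, Nat.mod_eq_of_lt ha'] at h1
    simp only [Nat.add_mul_div_left _ _ (show 0 < Z by omega), Nat.div_eq_of_lt ha,
      Nat.div_eq_of_lt ha', Nat.zero_add] at h2
    exact ⟨h1, h2⟩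
  obtain ⟨h1, h2⟩ := key hv hv' h
  obtain ⟨h3, h4⟩ := key hu hu' h2
  exact ⟨h1, h3, h4⟩

/-! ### The sampled nodes and the overlay graph -/

section Skeleton

open CongestAlgorithm WeightedNetwork

variable {n a : ℕ} (P : SSSPParams) {R : ℕ} {N : WeightedNetwork n a} (s : N.V) (e : ℕ)
  (ω : N.V → Fin R → Bool)

open Classical in
/-- The sampled nodes. -/
def skeleton : Finset N.V := Finset.univ.filter fun v => P.Sampled (localInput N s e v) (ω v)

/-- The final tables of the first `p` phases. -/
def tablesBefore (B Q τ p : ℕ) (v : N.V) : List Table :=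
  N.history B Q τ (fun u => P.spec (localInput N s e u) (ω u)) p v

/-- The values `2 ^ i * t` for which `t ≤ L` is the weight of a path from `u` to `v` with respect
to the weights divided by `2 ^ i`. -/
def roundedDists (u v : N.V) : Set ℕ :=
  {x | ∃ i ≤ P.I, ∃ t ≤ P.L, x = 2 ^ i * t ∧ ∃ h, WPath (Rounded i N.edge) u h v t}

/-- The overlay edges between sampled nodes. -/
def overlay (u v : N.V) (w : ℕ) : Prop :=
  u ∈ P.skeleton s e ω ∧ v ∈ P.skeleton s e ω ∧ u ≠ v ∧ (P.roundedDists u v).Nonempty ∧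
    w = sInf (P.roundedDists u v)

/-- The overlay edges published by one of their ends. -/
def publicOverlay (B Q τ : ℕ) (u v : N.V) (w : ℕ) : Prop :=
  P.overlay s e ω u v w ∧
    ((u : ℕ) ∈ P.published (localInput N s e v) (P.tablesBefore s e ω B Q τ (P.I + 1) v) ∨
      (v : ℕ) ∈ P.published (localInput N s e u) (P.tablesBefore s e ω B Q τ (P.I + 1) u))

variable {P s e ω}

theorem mem_skeleton {v : N.V} :
    v ∈ P.skeleton s e ω ↔ P.Sampled (localInput N s e v) (ω v) := by
  simp [skeleton]

theorem source_mem_skeleton : s ∈ P.skeleton s e ω := mem_skeleton.2 (Or.inl rfl)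

/-- The default weight 0 in `scaleSpec` is never used, since only neighbours can be heard. -/
theorem nbr_of_adj {u v : N.V} (h : N.graph.Adj u v) :
    ((localInput N s e v).nbr u).getD 0 = N.weight s(u, v) := by
  simp only [localInput]
  rw [dif_pos u.2, if_pos h.symm, Sym2.eq_swap]
  rfl

theorem roundedDists_comm (u v : N.V) : P.roundedDists u v = P.roundedDists v u := by
  have : ∀ u v : N.V, P.roundedDists u v ⊆ P.roundedDists v u := by
    rintro u v x ⟨i, hi, t, ht, rfl, h, p⟩
    refine ⟨i, hi, t, ht, rfl, h, p.symm ?_⟩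
    rintro x y _ ⟨w, e, rfl⟩
    exact ⟨w, edge_symm _ _ _ e, rfl⟩
  exact (this u v).antisymm (this v u)

theorem wdist_le_of_mem_roundedDists {u v : N.V} {x : ℕ} (h : x ∈ P.roundedDists u v) :
    N.wdist u v ≤ x := by
  obtain ⟨i, -, t, -, rfl, h, p⟩ := h
  obtain ⟨W, hW, q⟩ := p.of_rounded
  exact (wdist_le q).trans hW

theorem overlay_symm (u v : N.V) (w : ℕ) (h : P.overlay s e ω u v w) :
    P.overlay s e ω v u w := by
  obtain ⟨hu, hv, hne, hn, rfl⟩ := h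
  rw [roundedDists_comm] at hn ⊢
  exact ⟨hv, hu, hne.symm, hn, rfl⟩

theorem wdist_le_of_overlay {u v : N.V} {w : ℕ} (h : P.overlay s e ω u v w) :
    N.wdist u v ≤ w := by
  obtain ⟨hu, hv, hne, hn, rfl⟩ := h
  exact wdist_le_of_mem_roundedDists (Nat.sInf_mem hn)

theorem overlay_pos (u v : N.V) (w : ℕ) (h : P.overlay s e ω u v w) : 1 ≤ w := by
  have h1 := wdist_le_of_overlay h
  by_contra hw
  exact h.2.2.1 (eq_of_wdist_eq_zero (by omega))

theorem publicOverlay_symm {B Q τ : ℕ} (u v : N.V) (w : ℕ)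
    (h : P.publicOverlay s e ω B Q τ u v w) : P.publicOverlay s e ω B Q τ v u w :=
  ⟨overlay_symm _ _ _ h.1, h.2.symm⟩

/-- The tables contain only true values, but perhaps not all of them; it is enough that each omitted
value is dominated by a recorded one. -/
theorem sInf_eq_of_subset {A A' : Set ℕ} (h : A ⊆ A') (h' : ∀ b ∈ A', ∃ a ∈ A, a ≤ b) :
    sInf A = sInf A' ∧ (A.Nonempty ↔ A'.Nonempty) := by
  have hne : A.Nonempty ↔ A'.Nonempty :=
    ⟨fun ⟨x, hx⟩ => ⟨x, h hx⟩, fun ⟨x, hx⟩ => let ⟨y, hy, _⟩ := h' x hx; ⟨y, hy⟩⟩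
  refine ⟨?_, hne⟩
  rcases A'.eq_empty_or_nonempty with rfl | hn
  · rw [Set.subset_empty_iff.1 h]
  · refine le_antisymm ?_ (Nat.sInf_le (h (Nat.sInf_mem (hne.2 hn))))
    obtain ⟨y, hy, hle⟩ := h' _ (Nat.sInf_mem hn)
    exact (Nat.sInf_le hy).trans hle

/-! #### Detection of the sampled nodes -/

theorem reach_scaleSpec_iff {i : ℕ} {v : N.V} {θ t : ℕ} :
    N.Reach (fun u => P.scaleSpec (localInput N s e u) (ω u) i) v θ t ↔
      ∃ u ∈ P.skeleton s e ω, θ = u ∧ ∃ h, WPath (Rounded i N.edge) u h v t := by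
  constructor
  · intro h
    induction h with
    | @init v θ h => exact ⟨v, mem_skeleton.2 h.1, h.2, 0, .nil⟩
    | @hop x v θ W hadj _ ih =>
      obtain ⟨u, hu, rfl, h, p⟩ := ih
      refine ⟨u, hu, rfl, h + 1, p.snoc ⟨_, ⟨hadj, rfl⟩, ?_⟩⟩
      simp only [scaleSpec, nbr_of_adj hadj]
    | relay _ h => exact h.elim
  · rintro ⟨u, hu, rfl, h, p⟩
    induction p with
    | nil => exact .init ⟨mem_skeleton.1 hu, rfl⟩
    | snoc _ e' ih =>
      obtain ⟨w, ⟨hadj, rfl⟩, rfl⟩ := e'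
      have := Reach.hop hadj ih
      simpa only [scaleSpec, nbr_of_adj hadj] using this

variable {B Q τ h K M : ℕ}

theorem spec_of_le {i : ℕ} (hi : i ≤ P.I) (v : N.V) :
    P.spec (localInput N s e v) (ω v) (P.tablesBefore s e ω B Q τ i v) =
      P.scaleSpec (localInput N s e v) (ω v) i := by
  simp [spec, tablesBefore, length_history, hi]

theorem spec_publish (v : N.V) :
    P.spec (localInput N s e v) (ω v) (P.tablesBefore s e ω B Q τ (P.I + 1) v) =
      P.publishSpec (localInput N s e v) (ω v) (P.tablesBefore s e ω B Q τ (P.I + 1) v) := by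
  simp [spec, tablesBefore, length_history]

theorem spec_overlay (j : ℕ) (v : N.V) :
    P.spec (localInput N s e v) (ω v) (P.tablesBefore s e ω B Q τ (P.I + 2 + j) v) =
      P.overlaySpec (localInput N s e v) (ω v)
        (P.tablesBefore s e ω B Q τ (P.I + 2 + j) v) j := by
  unfold spec
  rw [if_neg (by rw [tablesBefore, length_history]; omega),
    if_neg (by rw [tablesBefore, length_history]; omega)]
  simp [tablesBefore, length_history]

theorem tablesBefore_getD {i p : ℕ} (hip : i < p) (v : N.V) :
    (P.tablesBefore s e ω B Q τ p v).getD i ∅ =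
      N.tables B Q (fun u => P.spec (localInput N s e u) (ω u)
        (P.tablesBefore s e ω B Q τ i u)) τ v :=
  history_getD hip v

theorem scale_getD {i p : ℕ} (hip : i < p) (hi : i ≤ P.I) (v : N.V) :
    (P.tablesBefore s e ω B Q τ p v).getD i ∅ =
      N.tables B Q (fun u => P.scaleSpec (localInput N s e u) (ω u) i) τ v := by
  rw [tablesBefore_getD hip]
  congr 1
  funext u
  exact spec_of_le hi u

theorem path_of_mem_scale {i p : ℕ} (hip : i < p) (hi : i ≤ P.I) {v : N.V} {θ t : ℕ}
    (h : (θ, t) ∈ (P.tablesBefore s e ω B Q τ p v).getD i ∅) :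
    ∃ u ∈ P.skeleton s e ω, θ = u ∧ ∃ h, WPath (Rounded i N.edge) u h v t := by
  rw [scale_getD hip hi] at h
  exact reach_scaleSpec_iff.1 (reach_of_mem_tables h)

theorem Fits.id_lt_tokens (hP : P.Fits N B Q τ h K M) (v : N.V) : (v : ℕ) < Q := by
  have h1 := hP.id_lt v
  exact h1.trans_le ((Nat.le_mul_of_pos_right _
    (Nat.mul_pos (by omega) (Nat.succ_pos _))).trans hP.code_le)

/-- The keys are rounded path weights and there is one token per sampled node, so `P.L + M` rounds
are enough. -/
theorem mem_scale_of_path (hP : P.Fits N B Q τ h K M) (hM : (P.skeleton s e ω).card ≤ M)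
    {i p : ℕ} (hip : i < p) (hi : i ≤ P.I) {u v : N.V} {t h' : ℕ} (hu : u ∈ P.skeleton s e ω)
    (ht : t ≤ P.L) (q : WPath (Rounded i N.edge) u h' v t) :
    ∃ t' ≤ t, ((u : ℕ), t') ∈ (P.tablesBefore s e ω B Q τ p v).getD i ∅ := by
  classical
  rw [scale_getD hip hi]
  refine exists_mem_tables (m := M) ?_ (fun _ _ _ _ _ h => False.elim h) ?_ hP.size
    (Θ := (P.skeleton s e ω).image (fun v : N.V => (v : ℕ))) ?_ (Finset.card_image_le.trans hM)
    (reach_scaleSpec_iff.2 ⟨u, hu, rfl, _, q⟩) (by have := hP.time_scale; omega)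
  · intro u v hadj
    simp only [scaleSpec, nbr_of_adj hadj]
    exact one_le_ceilShift (edge_pos _ _ _ ⟨hadj, rfl⟩)
  · intro v θ W hr
    obtain ⟨u, -, rfl, -⟩ := reach_scaleSpec_iff.1 hr
    exact hP.id_lt_tokens u
  · intro v θ W hr
    obtain ⟨u, hu, rfl, -⟩ := reach_scaleSpec_iff.1 hr
    exact Finset.mem_image_of_mem _ hu

/-- Both ends of an overlay edge compute the same weight, although each sees only its own tables. -/
theorem estimates_spec (hP : P.Fits N B Q τ h K M) (hM : (P.skeleton s e ω).card ≤ M)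
    {p : ℕ} (hp : P.I < p) {u : N.V} (hu : u ∈ P.skeleton s e ω) (v : N.V) :
    sInf (P.estimates (P.tablesBefore s e ω B Q τ p v) u) = sInf (P.roundedDists u v) ∧
      ((P.estimates (P.tablesBefore s e ω B Q τ p v) u).Nonempty ↔
        (P.roundedDists u v).Nonempty) := by
  refine sInf_eq_of_subset ?_ ?_
  · rintro x ⟨i, hi, t, ht, hm, rfl⟩
    obtain ⟨u', -, hu', q⟩ := path_of_mem_scale (by omega) hi hm
    obtain rfl := Subtype.ext hu'
    exact ⟨i, hi, t, ht, rfl, q⟩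
  · rintro x ⟨i, hi, t, ht, rfl, _, q⟩
    obtain ⟨t', ht', hm⟩ := mem_scale_of_path hP hM (show i < p by omega) hi hu ht q
    exact ⟨2 ^ i * t', ⟨i, hi, t', by omega, hm, rfl⟩, Nat.mul_le_mul_left _ ht'⟩

theorem mem_skeleton_of_estimates {p : ℕ} (hp : P.I < p) {v : N.V} {θ : ℕ}
    (h : (P.estimates (P.tablesBefore s e ω B Q τ p v) θ).Nonempty) :
    ∃ u ∈ P.skeleton s e ω, θ = u := by
  obtain ⟨_, i, hi, t, ht, hm, rfl⟩ := h
  obtain ⟨u, hu, hu', -⟩ := path_of_mem_scale (by omega) hi hm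
  exact ⟨u, hu, hu'⟩

/-! #### The published edges -/

theorem overlay_of_mem_candidates (hP : P.Fits N B Q τ h K M)
    (hM : (P.skeleton s e ω).card ≤ M) {v : N.V} (hv : v ∈ P.skeleton s e ω) {θ : ℕ}
    (hθ : θ ∈ P.candidates (localInput N s e v) (P.tablesBefore s e ω B Q τ (P.I + 1) v)) :
    ∃ u : N.V, θ = u ∧ P.overlay s e ω u v
      (sInf (P.estimates (P.tablesBefore s e ω B Q τ (P.I + 1) v) θ)) := by
  simp only [candidates, Finset.mem_filter] at hθ
  obtain ⟨-, hne, hest⟩ := hθ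
  obtain ⟨u, hu, rfl⟩ := mem_skeleton_of_estimates (by omega) hest
  have := estimates_spec hP hM (show P.I < P.I + 1 by omega) hu v
  exact ⟨u, rfl, hu, hv, fun h => hne (congrArg _ h), this.2.1 hest, this.1⟩

theorem mem_candidates_of_overlay (hP : P.Fits N B Q τ h K M)
    (hM : (P.skeleton s e ω).card ≤ M) {u v : N.V} {w : ℕ} (huv : P.overlay s e ω u v w) :
    (u : ℕ) ∈ P.candidates (localInput N s e v) (P.tablesBefore s e ω B Q τ (P.I + 1) v) ∧
      w = sInf (P.estimates (P.tablesBefore s e ω B Q τ (P.I + 1) v) u) := by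
  classical
  obtain ⟨hu, hv, hne, hn, rfl⟩ := huv
  have := estimates_spec hP hM (show P.I < P.I + 1 by omega) hu v
  refine ⟨?_, this.1.symm⟩
  simp only [candidates, Finset.mem_filter, Finset.mem_range]
  exact ⟨hP.id_lt u, fun h => hne (Subtype.ext h), this.2.2 hn⟩

theorem published_subset (inp : LocalInput) (past : List Table) :
    P.published inp past ⊆ P.candidates inp past := Finset.filter_subset _ _

theorem candidates_lt {inp : LocalInput} {past : List Table} {u : ℕ}
    (hu : u ∈ P.candidates inp past) : u < P.Z := by
  simp only [candidates, Finset.mem_filter, Finset.mem_range] at hu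
  exact hu.1

theorem card_published_le (inp : LocalInput) (past : List Table) :
    (P.published inp past).card ≤ P.k := by
  refine card_lightest_le fun u hu v hv huv => ?_
  have h1 := candidates_lt hu
  have h2 := candidates_lt hv
  have h3 := congrArg (· % P.Z) huv
  simpa [Nat.mul_comm _ P.Z, Nat.mul_add_mod, Nat.mod_eq_of_lt h1, Nat.mod_eq_of_lt h2] using h3

/-- An edge that `y` does not publish has lost against `k` edges at `y` that are at most as heavy.
This is the hypothesis on `F` in `exists_few_hops`. -/
theorem publicOverlay_lightest (hP : P.Fits N B Q τ h K M)
    (hM : (P.skeleton s e ω).card ≤ M) (y y' : N.V) (w : ℕ) (hw : P.overlay s e ω y y' w) :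
    P.publicOverlay s e ω B Q τ y y' w ∨ ∃ Z : Finset N.V, P.k ≤ Z.card ∧ y ∉ Z ∧
      ∀ z ∈ Z, ∃ w' ≤ w, P.publicOverlay s e ω B Q τ y z w' := by
  classical
  obtain ⟨hc, hwe⟩ := mem_candidates_of_overlay (B := B) (Q := Q) (τ := τ) hP hM
    (overlay_symm _ _ _ hw)
  by_cases hpub : (y' : ℕ) ∈ P.published (localInput N s e y)
      (P.tablesBefore s e ω B Q τ (P.I + 1) y)
  · exact Or.inl ⟨hw, Or.inr hpub⟩
  right
  obtain ⟨hcard, hkey⟩ := exists_lighter hc hpub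
  set past := P.tablesBefore s e ω B Q τ (P.I + 1) y with hpast
  have hfact : ∀ θ ∈ P.published (localInput N s e y) past, ∃ z : N.V, θ = z ∧
      P.overlay s e ω z y (sInf (P.estimates past θ)) := fun θ hθ =>
    overlay_of_mem_candidates hP hM hw.1 (published_subset _ _ hθ)
  refine ⟨Finset.univ.filter fun z : N.V => (z : ℕ) ∈ P.published (localInput N s e y) past,
    ?_, ?_, ?_⟩
  · refine hcard.trans ?_
    refine (Finset.card_le_card (t := (Finset.univ.filter fun z : N.V =>
      (z : ℕ) ∈ P.published (localInput N s e y) past).image fun z : N.V => (z : ℕ)) ?_).trans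
      Finset.card_image_le
    intro θ hθ
    obtain ⟨z, rfl, -⟩ := hfact θ hθ
    exact Finset.mem_image_of_mem _ (Finset.mem_filter.2 ⟨Finset.mem_univ _, hθ⟩)
  · intro hy
    obtain ⟨z, hz, ho⟩ := hfact y (Finset.mem_filter.1 hy).2
    exact ho.2.2.1 (Subtype.ext hz.symm)
  · intro z hz
    have hz' : (z : ℕ) ∈ P.published (localInput N s e y) past := (Finset.mem_filter.1 hz).2
    obtain ⟨z', hzz, ho⟩ := hfact z hz'
    obtain rfl := Subtype.ext hzz
    refine ⟨_, ?_, overlay_symm _ _ _ ho, Or.inr hz'⟩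
    have h1 := hkey z hz'
    rw [hwe]
    -- The keys are ordered by weight first, because the IDs that break ties are smaller than `P.Z`.
    by_contra hlt
    have h2 : (sInf (P.estimates past y') + 1) * P.Z ≤ sInf (P.estimates past z) * P.Z :=
      Nat.mul_le_mul_right _ (by omega)
    have h3 := hP.id_lt y'
    rw [add_mul] at h2
    omega

theorem reach_publishSpec {v : N.V} {θ W : ℕ}
    (hr : N.Reach (fun u => P.publishSpec (localInput N s e u) (ω u)
      (P.tablesBefore s e ω B Q τ (P.I + 1) u)) v θ W) :
    ∃ x ∈ P.skeleton s e ω, ∃ u ∈ P.published (localInput N s e x)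
      (P.tablesBefore s e ω B Q τ (P.I + 1) x),
      θ = P.code x u (sInf (P.estimates (P.tablesBefore s e ω B Q τ (P.I + 1) x) u)) := by
  induction hr with
  | @init v θ h => exact ⟨v, mem_skeleton.2 h.1, h.2⟩
  | hop _ _ ih => exact ih
  | relay _ h => exact h.elim

theorem publish_getD {p : ℕ} (hp : P.I + 1 < p) (v : N.V) :
    (P.tablesBefore s e ω B Q τ p v).getD (P.I + 1) ∅ =
      N.tables B Q (fun u => P.publishSpec (localInput N s e u) (ω u)
        (P.tablesBefore s e ω B Q τ (P.I + 1) u)) τ v := by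
  rw [tablesBefore_getD hp]
  congr 1
  funext u
  exact spec_publish u

/-- At most `M * k` tokens are broadcast over unit links, and each needs a key of at most the hop
diameter. -/
theorem mem_publish (hP : P.Fits N B Q τ h K M) (hM : (P.skeleton s e ω).card ≤ M)
    {p : ℕ} (hp : P.I + 1 < p) {x : N.V} (hx : x ∈ P.skeleton s e ω) {u : ℕ}
    (hu : u ∈ P.published (localInput N s e x) (P.tablesBefore s e ω B Q τ (P.I + 1) x))
    (v : N.V) :
    ∃ W, (P.code x u (sInf (P.estimates (P.tablesBefore s e ω B Q τ (P.I + 1) x) u)), W) ∈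
      (P.tablesBefore s e ω B Q τ p v).getD (P.I + 1) ∅ := by
  classical
  rw [publish_getD hp]
  set σ := fun u => P.publishSpec (localInput N s e u) (ω u)
    (P.tablesBefore s e ω B Q τ (P.I + 1) u) with hσ
  have h0 : N.Reach σ x
      (P.code x u (sInf (P.estimates (P.tablesBefore s e ω B Q τ (P.I + 1) x) u))) 0 :=
    .init ⟨mem_skeleton.1 hx, u, hu, rfl⟩
  obtain ⟨W, hW, hr⟩ := h0.spread (fun _ _ _ => rfl) v
  have hlt : ∀ v θ W, N.Reach σ v θ W → θ < Q := by
    intro v θ W hr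
    obtain ⟨x, hx, u, hu, rfl⟩ := reach_publishSpec hr
    have hcand := published_subset _ _ hu
    have hu' := candidates_lt hcand
    have hx' := hP.id_lt x
    simp only [candidates, Finset.mem_filter] at hcand
    obtain ⟨i, hi, t, ht, -, hxe⟩ := Nat.sInf_mem hcand.2.2
    refine lt_of_lt_of_le ?_ hP.code_le
    rw [hxe]
    have hle : 2 ^ i * t ≤ 2 ^ P.I * P.L :=
      Nat.mul_le_mul (Nat.pow_le_pow_right (by omega) hi) ht
    unfold code
    calc (x : ℕ) + P.Z * (u + P.Z * (2 ^ i * t))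
        < P.Z + P.Z * (u + P.Z * (2 ^ i * t)) := by omega
      _ = P.Z * ((u + 1) + P.Z * (2 ^ i * t)) := by ring
      _ ≤ P.Z * (P.Z + P.Z * (2 ^ P.I * P.L)) := by gcongr; omega
      _ = P.Z * (P.Z * (2 ^ P.I * P.L + 1)) := by ring
  have hΘ : ∀ v θ W, N.Reach σ v θ W → θ ∈ (P.skeleton s e ω).biUnion fun x =>
      (P.published (localInput N s e x) (P.tablesBefore s e ω B Q τ (P.I + 1) x)).image fun u =>
        P.code x u (sInf (P.estimates (P.tablesBefore s e ω B Q τ (P.I + 1) x) u)) := by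
    intro v θ W hr
    obtain ⟨x, hx, u, hu, rfl⟩ := reach_publishSpec hr
    exact Finset.mem_biUnion.2 ⟨x, hx, Finset.mem_image_of_mem _ hu⟩
  have hcard := (Finset.card_biUnion_le_card_mul (P.skeleton s e ω) (fun x =>
      (P.published (localInput N s e x) (P.tablesBefore s e ω B Q τ (P.I + 1) x)).image fun u =>
        P.code x u (sInf (P.estimates (P.tablesBefore s e ω B Q τ (P.I + 1) x) u))) P.k
    fun x _ => Finset.card_image_le.trans (card_published_le _ _)).trans
    (Nat.mul_le_mul_right _ hM)
  obtain ⟨W', -, hm⟩ := exists_mem_tables (σ := σ) (fun _ _ _ => le_rfl)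
    (fun _ _ _ _ _ h => False.elim h) hlt hP.size hΘ hcard hr
    (by have := hP.time_publish; omega)
  exact ⟨W', hm⟩

theorem publicEdge_of_publicOverlay (hP : P.Fits N B Q τ h K M)
    (hM : (P.skeleton s e ω).card ≤ M) {p : ℕ} (hp : P.I + 1 < p) (v : N.V) (x y : N.V) (w : ℕ)
    (hxy : P.publicOverlay s e ω B Q τ x y w) :
    P.publicEdge (P.tablesBefore s e ω B Q τ p v) x y w := by
  refine ⟨hP.id_lt x, hP.id_lt y, ?_⟩
  rcases hxy.2 with hpub | hpub
  · obtain ⟨W, hW⟩ := mem_publish hP hM hp hxy.1.2.1 hpub v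
    rw [← (mem_candidates_of_overlay hP hM hxy.1).2] at hW
    exact ⟨W, Or.inr hW⟩
  · obtain ⟨W, hW⟩ := mem_publish hP hM hp hxy.1.1 hpub v
    rw [← (mem_candidates_of_overlay hP hM (overlay_symm _ _ _ hxy.1)).2] at hW
    exact ⟨W, Or.inl hW⟩

theorem publicOverlay_of_publicEdge (hP : P.Fits N B Q τ h K M)
    (hM : (P.skeleton s e ω).card ≤ M) {p : ℕ} (hp : P.I + 1 < p) {v : N.V} {x y w : ℕ}
    (hxy : P.publicEdge (P.tablesBefore s e ω B Q τ p v) x y w) :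
    ∃ x' y' : N.V, x = x' ∧ y = y' ∧ P.publicOverlay s e ω B Q τ x' y' w := by
  have key : ∀ {x y W : ℕ}, x < P.Z → y < P.Z →
      (P.code x y w, W) ∈ (P.tablesBefore s e ω B Q τ p v).getD (P.I + 1) ∅ →
      ∃ x' y' : N.V, x = x' ∧ y = y' ∧ P.publicOverlay s e ω B Q τ x' y' w := by
    intro x y W hx hy hm
    rw [publish_getD hp] at hm
    obtain ⟨x', hx', u, hu, hcode⟩ := reach_publishSpec (reach_of_mem_tables hm)
    obtain ⟨rfl, rfl, rfl⟩ := code_inj hx (hP.id_lt _) hy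
      (candidates_lt (published_subset _ _ hu)) hcode
    obtain ⟨y', rfl, ho⟩ := overlay_of_mem_candidates hP hM hx' (published_subset _ _ hu)
    exact ⟨x', y', rfl, rfl, overlay_symm _ _ _ ho, Or.inr hu⟩
  obtain ⟨hx, hy, W, hm | hm⟩ := hxy
  · exact key hx hy hm
  · obtain ⟨y', x', h1, h2, h3⟩ := key hy hx hm
    exact ⟨x', y', h2, h1, publicOverlay_symm _ _ _ h3⟩

theorem wdist_le_of_publicEdge_path (hP : P.Fits N B Q τ h K M)
    (hM : (P.skeleton s e ω).card ≤ M) {p : ℕ} (hp : P.I + 1 < p) {v : N.V} {x : N.V} {y l w : ℕ}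
    (q : WPath (P.publicEdge (P.tablesBefore s e ω B Q τ p v)) x l y w) :
    ∃ y' : N.V, y = y' ∧ N.wdist x y' ≤ w := by
  induction q with
  | nil => exact ⟨x, rfl, (wdist_self x).le⟩
  | snoc _ e' ih =>
    obtain ⟨z, rfl, hz⟩ := ih
    obtain ⟨z', y', hzz, rfl, ho⟩ := publicOverlay_of_publicEdge hP hM hp e'
    obtain rfl := Subtype.ext hzz
    have := wdist_triangle x z y'
    have := wdist_le_of_overlay ho.1
    exact ⟨y', rfl, by omega⟩

/-! #### Distances on the overlay -/

theorem overlay_getD {j p : ℕ} (hp : P.I + 2 + j < p) (v : N.V) :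
    (P.tablesBefore s e ω B Q τ p v).getD (P.I + 2 + j) ∅ =
      N.tables B Q (fun u => P.overlaySpec (localInput N s e u) (ω u)
        (P.tablesBefore s e ω B Q τ (P.I + 2 + j) u) j) τ v := by
  rw [tablesBefore_getD hp]
  congr 1
  funext u
  exact spec_overlay j u

theorem wdist_le_of_mem_scale {i p : ℕ} (hip : i < p) (hi : i ≤ P.I) {u v : N.V} {t : ℕ}
    (hm : ((u : ℕ), t) ∈ (P.tablesBefore s e ω B Q τ p v).getD i ∅) :
    N.wdist u v ≤ 2 ^ i * t := by
  obtain ⟨u', -, huu, _, q⟩ := path_of_mem_scale hip hi hm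
  obtain rfl := Subtype.ext huu
  obtain ⟨W, hW, q⟩ := q.of_rounded
  exact (wdist_le q).trans hW

/-- Soundness: broadcasting can only increase `W / P.D`, and each relay pays for a genuine path with
its weight rounded up. -/
theorem reach_overlaySpec (hP : P.Fits N B Q τ h K M) (hM : (P.skeleton s e ω).card ≤ M)
    {j : ℕ} {v : N.V} {θ W : ℕ}
    (hr : N.Reach (fun u => P.overlaySpec (localInput N s e u) (ω u)
      (P.tablesBefore s e ω B Q τ (P.I + 2 + j) u) j) v θ W) :
    ∃ u ∈ P.skeleton s e ω, θ = u ∧ N.wdist s u ≤ 2 ^ j * (W / P.D) := by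
  have hD := hP.diam_lt
  induction hr with
  | @init v θ h =>
    obtain ⟨h1, h2⟩ := h
    obtain rfl : v = s := Subtype.ext h2
    exact ⟨v, source_mem_skeleton, h1, by simp [wdist_self]⟩
  | hop _ _ ih =>
    obtain ⟨u, hu, rfl, hle⟩ := ih
    exact ⟨u, hu, rfl, hle.trans
      (Nat.mul_le_mul_left _ (Nat.div_le_div_right (Nat.le_add_right _ _)))⟩
  | @relay v θ W θ' W' _ h ih =>
    obtain ⟨u, hu, rfl, hle⟩ := ih
    obtain ⟨hv, rfl, x, -, hx, rfl⟩ := h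
    refine ⟨v, mem_skeleton.2 hv, rfl, ?_⟩
    have hux : N.wdist u v ≤ x := by
      rcases hx with ⟨i, hi, t, hm, rfl⟩ | ⟨l, q⟩
      · exact wdist_le_of_mem_scale (by omega) hi hm
      · obtain ⟨v', hvv, hle⟩ := wdist_le_of_publicEdge_path hP hM (by omega) q
        obtain rfl : v = v' := Subtype.ext hvv
        exact hle
    rw [Nat.mul_div_cancel_left _ (by omega), mul_add]
    have := wdist_triangle s u v
    have := le_two_pow_mul_ceilShift j x
    omega

/-- Each hop of the overlay path is a broadcast from its start followed by a relay at its end. -/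
theorem reach_of_overlay_path (hP : P.Fits N B Q τ h K M) (hM : (P.skeleton s e ω).card ≤ M)
    {j l t : ℕ} {u : N.V}
    (q : WPath (Rounded j (Shortcut (P.overlay s e ω) (P.publicOverlay s e ω B Q τ))) s l u t) :
    ∃ W ≤ P.D * t, N.Reach (fun u => P.overlaySpec (localInput N s e u) (ω u)
      (P.tablesBefore s e ω B Q τ (P.I + 2 + j) u) j) u u W := by
  have hD := hP.diam_lt
  have hmemS : ∀ {l W : ℕ} {x y : N.V}, WPath (P.publicOverlay s e ω B Q τ) x l y W →
      1 ≤ W → y ∈ P.skeleton s e ω := by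
    intro l W x y r hW
    cases r with
    | nil => omega
    | snoc _ h => exact h.1.2.1
  induction q with
  | nil => exact ⟨0, Nat.zero_le _, .init ⟨rfl, rfl⟩⟩
  | @snoc l v y t w _ e' ih =>
    obtain ⟨x, ⟨hx1, hx⟩, rfl⟩ := e'
    obtain ⟨W₀, hW₀, hr₀⟩ := ih
    obtain ⟨W, hW, hr⟩ := hr₀.spread (fun _ _ _ => rfl) y
    -- The broadcast adds at most the hop diameter, which is less than `P.D`, so the delay
    -- disappears in the quotient and does not accumulate over the hops.
    have hdiv : W / P.D ≤ t := by
      refine Nat.lt_succ_iff.1 ((Nat.div_lt_iff_lt_mul (by omega)).2 ?_)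
      rw [Nat.succ_mul, Nat.mul_comm t]
      omega
    refine ⟨P.D * (W / P.D + ceilShift j x), by gcongr, ?_⟩
    rcases hx with hx | ⟨l', r⟩
    · obtain ⟨hv, hy, hne, hn, rfl⟩ := hx
      have hest := estimates_spec hP hM (show P.I < P.I + 2 + j by omega) hv y
      obtain ⟨i, hi, t', -, hm, hxt⟩ := Nat.sInf_mem (hest.2.2 hn)
      refine .relay hr ⟨mem_skeleton.1 hy, rfl, _, hx1, Or.inl ⟨i, hi, t', hm, ?_⟩, rfl⟩
      rw [← hest.1, hxt]
    · refine .relay hr ⟨mem_skeleton.1 (hmemS r hx1), rfl, x, hx1, Or.inr ⟨l', ?_⟩, rfl⟩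
      exact r.map (fun v : N.V => (v : ℕ)) (publicEdge_of_publicOverlay hP hM (by omega) y)

theorem exists_mem_overlay_table (hP : P.Fits N B Q τ h K M)
    (hM : (P.skeleton s e ω).card ≤ M) {j l t p : ℕ} (hp : P.I + 2 + j < p) {u : N.V}
    (ht : t ≤ (5 * (M / (P.k + 1)) + 2) * (K + 1))
    (q : WPath (Rounded j (Shortcut (P.overlay s e ω) (P.publicOverlay s e ω B Q τ))) s l u t)
    (v : N.V) :
    ∃ W, W / P.D ≤ t ∧
      ((u : ℕ), W) ∈ (P.tablesBefore s e ω B Q τ p v).getD (P.I + 2 + j) ∅ := by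
  classical
  have hD := hP.diam_lt
  obtain ⟨W₀, hW₀, hr₀⟩ := reach_of_overlay_path hP hM q
  obtain ⟨W, hW, hr⟩ := hr₀.spread (fun _ _ _ => rfl) v
  rw [overlay_getD hp]
  have hDt := Nat.mul_le_mul_left P.D ht
  set σ := fun u => P.overlaySpec (localInput N s e u) (ω u)
    (P.tablesBefore s e ω B Q τ (P.I + 2 + j) u) j with hσ
  have hrelay : ∀ v θ W θ' W', (σ v).relay θ W θ' W' → W < W' ∧
      ∀ W₀ ≤ W, ∃ W₁ ≤ W', (σ v).relay θ W₀ θ' W₁ := by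
    rintro v θ W θ' _ ⟨hv, hθ, x, hx, hxe, rfl⟩
    constructor
    · have h1 := Nat.div_add_mod W P.D
      have h2 := Nat.mod_lt W (show 0 < P.D by omega)
      have h3 := Nat.le_mul_of_pos_right P.D (one_le_ceilShift (i := j) hx)
      rw [mul_add]
      omega
    · intro W₀ hW₀
      exact ⟨P.D * (W₀ / P.D + ceilShift j x), by gcongr, hv, hθ, x, hx, hxe, rfl⟩
  have hlt : ∀ v θ W, N.Reach σ v θ W → θ < Q := by
    intro v θ W hr
    obtain ⟨u, -, rfl, -⟩ := reach_overlaySpec hP hM hr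
    exact hP.id_lt_tokens u
  have hΘ : ∀ v θ W, N.Reach σ v θ W →
      θ ∈ (P.skeleton s e ω).image (fun v : N.V => (v : ℕ)) := by
    intro v θ W hr
    obtain ⟨u, hu, rfl, -⟩ := reach_overlaySpec hP hM hr
    exact Finset.mem_image_of_mem _ hu
  obtain ⟨W', hW', hm⟩ := exists_mem_tables (fun _ _ _ => le_rfl) hrelay hlt hP.size hΘ
    (Finset.card_image_le.trans hM) hr (by have := hP.time_overlay; omega)
  refine ⟨W', Nat.lt_succ_iff.1 ((Nat.div_lt_iff_lt_mul (by omega)).2 ?_), hm⟩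
  rw [Nat.succ_mul, Nat.mul_comm t]
  omega

/-! #### The outputs -/

/-- Every node other than the source has a sampled node within `h` hops before it on a shortest
path from the source. -/
def Hit (P : SSSPParams) (s : N.V) (e : ℕ) (ω : N.V → Fin R → Bool) (h : ℕ) : Prop :=
  ∀ v, v ≠ s → ∃ u ∈ P.skeleton s e ω, u ≠ v ∧ ∃ l ≤ h, ∃ W, WPath N.edge u l v W ∧
    N.wdist s u + W = N.wdist s v

theorem exists_estimate (hP : P.Fits N B Q τ h K M) {u v : N.V} {l W : ℕ} (hl : l ≤ h)
    (q : WPath N.edge u l v W) :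
    ∃ i ≤ P.I, ∃ t ≤ P.L, WPath (Rounded i N.edge) u l v t ∧ K * (2 ^ i * t) ≤ (K + 2) * W := by
  rw [hP.L_eq]
  refine q.exists_scale hl ?_
  have hn : 1 ≤ n := by
    rw [← N.card_V]
    exact Finset.card_pos.2 ⟨u, u.2⟩
  calc W ≤ l * n ^ a := wpath_weight_le q
    _ ≤ h * (n * n ^ a) := by
      exact Nat.mul_le_mul hl (Nat.le_mul_of_pos_left _ hn)
    _ ≤ h * 2 ^ P.I := Nat.mul_le_mul_left _ (by have := hP.scale_le; omega)
    _ ≤ 2 ^ P.I * (h * K) := by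
      rw [mul_comm]
      exact Nat.mul_le_mul_left _ (Nat.le_mul_of_pos_right _ hP.one_le_K)

/-- Backwards from `v`, each hit gives a sampled node strictly nearer to the source. Every piece has
at most `h` hops and its own factor `(K + 2) / K`, so the sum has the same factor. -/
theorem exists_overlay_path (hP : P.Fits N B Q τ h K M) (hhit : Hit P s e ω h) {v : N.V}
    (hv : v ∈ P.skeleton s e ω) :
    ∃ l W, WPath (P.overlay s e ω) s l v W ∧ K * W ≤ (K + 2) * N.wdist s v := by
  induction hd : N.wdist s v using Nat.strong_induction_on generalizing v with
  | _ d ih =>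
    subst hd
    by_cases hvs : v = s
    · subst hvs
      exact ⟨0, 0, .nil, by simp⟩
    obtain ⟨u, hu, huv, l, hl, W, q, hW⟩ := hhit v hvs
    have hWpos : W ≠ 0 := by
      rintro rfl
      exact huv (q.eq_of_weight_zero edge_pos)
    obtain ⟨l₁, W₁, q₁, hW₁⟩ := ih _ (by omega) hu rfl
    obtain ⟨i, hi, t, ht, r, hle⟩ := exists_estimate hP hl q
    have hmem : 2 ^ i * t ∈ P.roundedDists u v := ⟨i, hi, t, ht, rfl, l, r⟩
    refine ⟨l₁ + 1, _, q₁.snoc ⟨hu, hv, huv, ⟨_, hmem⟩, rfl⟩, ?_⟩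
    rw [← hW, mul_add, mul_add]
    exact add_le_add hW₁ ((Nat.mul_le_mul_left _ (Nat.sInf_le hmem)).trans hle)

/-- The part up to the last sampled node is rounded twice, in the network and on the overlay; the
remaining piece only once. -/
theorem exists_output_le (hP : P.Fits N B Q τ h K M) (hM : (P.skeleton s e ω).card ≤ M)
    (hhit : Hit P s e ω h) (v : N.V) :
    ∃ x ∈ P.outputs (P.tablesBefore s e ω B Q τ (2 * P.I + 3) v),
      K ^ 2 * x ≤ (K + 2) ^ 2 * N.wdist s v := by
  obtain ⟨u, hu, l, hl, W, q, hW⟩ : ∃ u ∈ P.skeleton s e ω, ∃ l ≤ h, ∃ W,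
      WPath N.edge u l v W ∧ N.wdist s u + W = N.wdist s v := by
    by_cases hv : v = s
    · subst hv
      exact ⟨v, source_mem_skeleton, 0, Nat.zero_le _, 0, .nil, rfl⟩
    · obtain ⟨u, hu, -, h⟩ := hhit v hv
      exact ⟨u, hu, h⟩
  obtain ⟨i, hi, t, ht, r, hle⟩ := exists_estimate hP hl q
  obtain ⟨t₀, ht₀, hm⟩ := mem_scale_of_path hP hM (show i < 2 * P.I + 3 by omega) hi hu ht r
  obtain ⟨l₁, W₁, q₁, hW₁⟩ := exists_overlay_path hP hhit hu
  obtain ⟨H, hH, W₂, hW₂, q₂⟩ := exists_few_hops (F := P.publicOverlay s e ω B Q τ)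
    (S := P.skeleton s e ω) (k := P.k) overlay_pos overlay_symm (fun _ _ _ h => h.1)
    publicOverlay_symm (fun _ _ _ h => h.2.1) hP.one_le_k (publicOverlay_lightest hP hM)
    source_mem_skeleton q₁
  have hHM : H ≤ 5 * (M / (P.k + 1)) + 2 := hH.trans (by gcongr)
  obtain ⟨j, hj, t', ht', r', hle'⟩ := q₂.exists_scale (I := P.I) (K := K) hHM (by
    -- Since `K ≥ 1`, the first rounding costs a factor of at most 3, which is the 3 in `scale_le`.
    have h1 : W₁ ≤ 3 * N.wdist s u := by
      refine Nat.le_of_mul_le_mul_left (hW₁.trans ?_) hP.one_le_K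
      have := hP.one_le_K
      rw [← mul_assoc]
      exact Nat.mul_le_mul_right _ (by omega)
    have h2 : N.wdist s u ≤ n * n ^ a := wdist_le_card_mul s u
    have h3 := hP.scale_le
    refine le_trans (show W₂ ≤ 2 ^ P.I by omega) (Nat.le_mul_of_pos_right _
      (Nat.mul_pos (by omega) hP.one_le_K)))
  obtain ⟨W₃, hW₃, hm'⟩ := exists_mem_overlay_table hP hM
    (show P.I + 2 + j < 2 * P.I + 3 by omega) ht' r' v
  refine ⟨_, ⟨i, hi, j, hj, u, t₀, W₃, hm, hm', rfl⟩, ?_⟩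
  have h1 : K * (2 ^ j * (W₃ / P.D)) ≤ (K + 2) * W₁ :=
    ((Nat.mul_le_mul_left _ (Nat.mul_le_mul_left _ hW₃)).trans hle').trans
      (Nat.mul_le_mul_left _ hW₂)
  have h2 : K * (2 ^ i * t₀) ≤ (K + 2) * W :=
    (Nat.mul_le_mul_left _ (Nat.mul_le_mul_left _ ht₀)).trans hle
  calc K ^ 2 * (2 ^ j * (W₃ / P.D) + 2 ^ i * t₀)
      = K * (K * (2 ^ j * (W₃ / P.D))) + K * (K * (2 ^ i * t₀)) := by ring
    _ ≤ K * ((K + 2) * W₁) + K * ((K + 2) * W) := by gcongr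
    _ = (K + 2) * (K * W₁) + K * ((K + 2) * W) := by ring
    _ ≤ (K + 2) * ((K + 2) * N.wdist s u) + (K + 2) * ((K + 2) * W) := by gcongr; omega
    _ = (K + 2) ^ 2 * N.wdist s v := by rw [← hW]; ring

theorem wdist_le_of_mem_outputs (hP : P.Fits N B Q τ h K M)
    (hM : (P.skeleton s e ω).card ≤ M) {v : N.V} {x : ℕ}
    (hx : x ∈ P.outputs (P.tablesBefore s e ω B Q τ (2 * P.I + 3) v)) : N.wdist s v ≤ x := by
  obtain ⟨i, hi, j, hj, θ, t, W, h1, h2, rfl⟩ := hx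
  rw [overlay_getD (by omega)] at h2
  obtain ⟨u, -, rfl, hle⟩ := reach_overlaySpec hP hM (reach_of_mem_tables h2)
  have := wdist_le_of_mem_scale (by omega) hi h1
  have := wdist_triangle s u v
  omega

end Skeleton

/-- The output of a node that knows the final tables of all phases. -/
def output (P : SSSPParams) (past : List Table) : ℚ := ((sInf (P.outputs past) : ℕ) : ℚ)

end SSSPParams

/-- The algorithm with parameters `P` and phases of `τ` rounds, both depending on the estimate of
the diameter. -/
def ssspAlgorithm (B R Q I : ℕ) (τ : ℕ → ℕ) (P : ℕ → SSSPParams) : CongestAlgorithm B R :=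
  phasedAlgorithm B R Q (2 * I + 3) (fun inp => τ inp.diamEstimate)
    (fun inp => (P inp.diamEstimate).spec inp) (fun inp _ => (P inp.diamEstimate).output)

theorem ssspAlgorithm_solves {n a B R Q I h K M e : ℕ} {τ : ℕ → ℕ} {P : ℕ → SSSPParams}
    {N : WeightedNetwork n a} {s : N.V} {ω : N.V → Fin R → Bool} (hI : (P e).I = I)
    (hP : (P e).Fits N B Q (τ e) h K M) (hM : ((P e).skeleton s e ω).card ≤ M)
    (hhit : SSSPParams.Hit (P e) s e ω h) {α T : ℝ} (hα : ((K + 2 : ℝ) / K) ^ 2 ≤ α)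
    (hT : ((2 * I + 3) * τ e : ℝ) ≤ T) :
    (ssspAlgorithm B R Q I τ P).SolvesSSSPWithin N s e ω α T := by
  refine ⟨(2 * I + 3) * τ e, by exact_mod_cast hT, fun v => ?_⟩
  have hτ : 1 ≤ τ e := by
    have := hP.time_overlay
    have := hP.diam_lt
    have h1 : 1 ≤ (P e).D * ((5 * (M / ((P e).k + 1)) + 2) * (K + 1)) :=
      Nat.mul_pos (by omega) (by positivity)
    omega
  have hrun := run_phasedAlgorithm_end (B := B) (Q := Q) (P := 2 * I + 3) (N := N) (s := s)
    (τ := fun inp => τ inp.diamEstimate) (spec := fun inp => (P inp.diamEstimate).spec inp)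
    (out := fun inp _ => (P inp.diamEstimate).output) (ω := ω) (fun _ => rfl) hτ (by omega) v
  obtain ⟨x, hx, hxle⟩ := SSSPParams.exists_output_le hP hM hhit v
  rw [hI] at hx
  set d := sInf ((P e).outputs ((P e).tablesBefore s e ω B Q (τ e) (2 * I + 3) v)) with hd
  have hrun' : (ssspAlgorithm B R Q I τ P).run N s e ω ((2 * I + 3) * τ e) v =
      .halted (d : ℚ) := hrun
  refine ⟨_, hrun', ?_, ?_⟩
  · have : N.wdist s v ≤ d := SSSPParams.wdist_le_of_mem_outputs hP hM
      (by rw [hd, hI]; exact Nat.sInf_mem ⟨x, hx⟩)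
    exact_mod_cast this
  · have hle : d ≤ x := Nat.sInf_le hx
    have hK : (0 : ℝ) < K := by exact_mod_cast hP.one_le_K
    have hxle' : (K : ℝ) ^ 2 * x ≤ (K + 2) ^ 2 * N.wdist s v := by exact_mod_cast hxle
    have hx' : (x : ℝ) ≤ ((K + 2 : ℝ) / K) ^ 2 * N.wdist s v := by
      rw [div_pow, div_mul_eq_mul_div, le_div_iff₀ (by positivity)]
      linarith
    refine le_trans ?_ (hx'.trans (mul_le_mul_of_nonneg_right hα (Nat.cast_nonneg _)))
    exact_mod_cast hle

/-! ### Random samples -/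

section Sampling

variable {V β : Type*} [Fintype V] [DecidableEq V] [Fintype β]

/-- Independence of the nodes, in counting form. -/
theorem sum_prod_eq (f : V → β → ℝ) : ∑ ω : V → β, ∏ v, f v (ω v) = ∏ v, ∑ b, f v b := by
  rw [Finset.prod_univ_sum, Fintype.piFinset_univ]

variable [DecidableEq β] (G : Finset β) {p : ℝ} (hp : (G.card : ℝ) = p * Fintype.card β)

include hp

/-- The proportion is `(1 - p) ^ A.card`, and `1 - p ≤ exp (-p)`. -/
theorem card_avoid_le (hp1 : p ≤ 1) (A : Finset V) :
    ((Finset.univ.filter fun ω : V → β => ∀ u ∈ A, ω u ∉ G).card : ℝ) ≤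
      Real.exp (-(p * A.card)) * Fintype.card (V → β) := by
  have h1 : ((Finset.univ.filter fun ω : V → β => ∀ u ∈ A, ω u ∉ G).card : ℝ) =
      ∑ ω : V → β, ∏ v, (if v ∈ A then (if ω v ∈ G then (0 : ℝ) else 1) else 1) := by
    rw [Finset.card_filter, Nat.cast_sum]
    refine Finset.sum_congr rfl fun ω _ => ?_
    split_ifs with h
    · rw [Finset.prod_eq_one]
      · simp
      · intro v _
        split_ifs with h1 h2
        · exact absurd h2 (h v h1)
        · rfl
        · rfl
    · push Not at h
      obtain ⟨u, hu, hG⟩ := h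
      rw [Finset.prod_eq_zero (Finset.mem_univ u) (by simp [hu, hG])]
      simp
  have h2 : ∀ v, ∑ b : β, (if v ∈ A then (if b ∈ G then (0 : ℝ) else 1) else 1) =
      (if v ∈ A then 1 - p else 1) * Fintype.card β := by
    intro v
    split_ifs with hv
    · have : ∀ b : β, (if b ∈ G then (0 : ℝ) else 1) = 1 - if b ∈ G then 1 else 0 := by
        intro b; split_ifs <;> simp
      simp only [this, Finset.sum_sub_distrib]
      simp [hp]
      ring
    · simp
  rw [h1, sum_prod_eq (fun v b => if v ∈ A then (if b ∈ G then (0 : ℝ) else 1) else 1)]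
  simp only [h2]
  rw [Finset.prod_mul_distrib, Finset.prod_const, Finset.prod_ite_mem, Finset.prod_const,
    Finset.univ_inter, Fintype.card_fun, Finset.card_univ, Nat.cast_pow]
  refine mul_le_mul_of_nonneg_right ?_ (by positivity)
  rw [show -(p * (A.card : ℝ)) = (A.card : ℝ) * (-p) by ring, Real.exp_nat_mul]
  refine pow_le_pow_left₀ (by linarith) ?_ _
  have := Real.add_one_le_exp (-p)
  linarith

/-- Markov's inequality for two to the power of the sample size, whose mean is `(1 + p)` to the
number of nodes. -/
theorem card_large_le (hp0 : 0 ≤ p) (m : ℕ) :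
    ((Finset.univ.filter fun ω : V → β =>
      m ≤ (Finset.univ.filter fun v => ω v ∈ G).card).card : ℝ) ≤
      Real.exp (p * Fintype.card V) / 2 ^ m * Fintype.card (V → β) := by
  have h1 : ((Finset.univ.filter fun ω : V → β =>
      m ≤ (Finset.univ.filter fun v => ω v ∈ G).card).card : ℝ) * 2 ^ m ≤
      ∑ ω : V → β, ∏ v, (if ω v ∈ G then (2 : ℝ) else 1) := by
    rw [← nsmul_eq_mul]
    refine (Finset.card_nsmul_le_sum _ (fun ω : V → β =>
      ∏ v, (if ω v ∈ G then (2 : ℝ) else 1)) _ fun ω hω => ?_).trans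
      (Finset.sum_le_sum_of_subset_of_nonneg (Finset.filter_subset _ _) fun ω _ _ =>
        Finset.prod_nonneg fun v _ => by split_ifs <;> norm_num)
    rw [Finset.mem_filter] at hω
    rw [Finset.prod_ite, Finset.prod_const, Finset.prod_const_one, mul_one]
    exact pow_le_pow_right₀ one_le_two hω.2
  have h2 : ∑ b : β, (if b ∈ G then (2 : ℝ) else 1) = (1 + p) * Fintype.card β := by
    have : ∀ b : β, (if b ∈ G then (2 : ℝ) else 1) = 1 + if b ∈ G then 1 else 0 := by
      intro b; split_ifs <;> norm_num
    simp only [this, Finset.sum_add_distrib]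
    simp [hp]
    ring
  rw [sum_prod_eq (fun _ b => if b ∈ G then (2 : ℝ) else 1)] at h1
  simp only [h2] at h1
  rw [Finset.prod_const, mul_pow, Finset.card_univ] at h1
  rw [div_mul_eq_mul_div, le_div_iff₀ (by positivity), Fintype.card_fun, Nat.cast_pow]
  refine h1.trans (mul_le_mul_of_nonneg_right ?_ (by positivity))
  rw [mul_comm p, Real.exp_nat_mul]
  refine pow_le_pow_left₀ (by linarith) ?_ _
  have := Real.add_one_le_exp p
  linarith

end Sampling

theorem card_prefix_true {R q : ℕ} (hq : q ≤ R) :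
    ((Finset.univ.filter fun b : Fin R → Bool => ∀ i : Fin R, (i : ℕ) < q → b i = true).card : ℝ)
      = 1 / 2 ^ q * Fintype.card (Fin R → Bool) := by
  classical
  have h1 : (Finset.univ.filter fun b : Fin R → Bool =>
      ∀ i : Fin R, (i : ℕ) < q → b i = true) =
      Fintype.piFinset fun i : Fin R => if (i : ℕ) < q then {true} else Finset.univ := by
    ext b
    simp only [Finset.mem_filter, Finset.mem_univ, true_and, Fintype.mem_piFinset]
    refine forall_congr' fun i => ?_
    split_ifs with h <;> simp [h]
  have h2 : (Fintype.piFinset fun i : Fin R =>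
      if (i : ℕ) < q then ({true} : Finset Bool) else Finset.univ).card = 2 ^ (R - q) := by
    rw [Fintype.card_piFinset]
    have : ∀ i : Fin R, (if (i : ℕ) < q then ({true} : Finset Bool) else Finset.univ).card =
        if (i : ℕ) < q then 1 else 2 := fun i => by split_ifs <;> rfl
    simp only [this]
    rw [Fin.prod_univ_eq_prod_range (fun i => if i < q then 1 else 2) R, Finset.prod_ite,
      Finset.prod_const_one, one_mul, Finset.prod_const]
    congr 1
    have : (Finset.range R).filter (fun i => ¬ i < q) = Finset.Ico q R := by
      ext i
      simp only [Finset.mem_filter, Finset.mem_range, Finset.mem_Ico]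
      omega
    rw [this, Nat.card_Ico]
  rw [h1, h2]
  simp only [Fintype.card_fun, Fintype.card_bool, Fintype.card_fin]
  push_cast
  rw [pow_sub₀ _ two_ne_zero hq]
  ring

namespace WeightedNetwork

variable {n a : ℕ} {N : WeightedNetwork n a}

/-- Before every vertex of a shortest path there are `h` other vertices on this path, unless the
source is among them. -/
theorem exists_predecessors (s v : N.V) (h : ℕ) :
    (∃ l ≤ h, WPath N.edge s l v (N.wdist s v)) ∨
    ∃ A : Finset N.V, A.card = h ∧ h < n ∧ ∀ u ∈ A, u ≠ v ∧
      ∃ l ≤ h, ∃ W, WPath N.edge u l v W ∧ N.wdist s u + W = N.wdist s v := by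
  classical
  obtain ⟨m, p⟩ := exists_shortest s v
  by_cases hm : m ≤ h
  · exact Or.inl ⟨m, hm, p⟩
  right
  obtain ⟨x, c, hx0, hxm, hc0, hcm, hs⟩ := p.exists_sequence
  have hdist : ∀ i ≤ m, N.wdist s (x i) = c i ∧ c i ≤ c m := by
    intro i hi
    have h1 := WPath.of_sequence hs (Nat.zero_le i) hi
    have h2 := WPath.of_sequence hs hi le_rfl
    have h3 := wdist_le h1.2
    have h4 := wdist_le h2.2
    rw [hx0] at h3
    rw [hxm] at h4
    have := wdist_triangle s (x i) v
    omega
  have hstrict : ∀ i < m, c i < c (i + 1) := fun i hi => by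
    obtain ⟨w, e, hw⟩ := hs i hi
    have := edge_pos _ _ _ e
    omega
  have hlt : ∀ i j, i < j → j ≤ m → c i < c j := by
    intro i j hij hj
    have := hstrict i (by omega)
    have := (WPath.of_sequence hs (show i + 1 ≤ j by omega) hj).1
    omega
  have hinj : Set.InjOn x (Finset.Icc (m - h) m : Set ℕ) := by
    intro i hi j hj hij
    simp only [Finset.coe_Icc, Set.mem_Icc] at hi hj
    have h1 := (hdist i hi.2).1
    rw [hij, (hdist j hj.2).1] at h1
    rcases lt_trichotomy i j with h' | h' | h'
    · have := hlt i j h' hj.2; omega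
    · exact h'
    · have := hlt j i h' hi.2; omega
  have hcard := Finset.card_image_of_injOn hinj
  refine ⟨(Finset.Ico (m - h) m).image x, ?_, ?_, ?_⟩
  · rw [Finset.card_image_of_injOn (hinj.mono (by
      rw [Finset.coe_Ico, Finset.coe_Icc]; exact Set.Ico_subset_Icc_self)), Nat.card_Ico]
    omega
  · have h1 := Finset.card_le_univ ((Finset.Icc (m - h) m).image x)
    rw [hcard, Nat.card_Icc, Fintype.card_coe, N.card_V] at h1
    omega
  · intro u hu
    obtain ⟨i, hi, rfl⟩ := Finset.mem_image.1 hu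
    rw [Finset.mem_Ico] at hi
    have h1 := hdist i hi.2.le
    have h2 := hlt i m hi.2 le_rfl
    have h3 := WPath.of_sequence hs hi.2.le le_rfl
    refine ⟨fun he => ?_, m - i, by omega, c m - c i, ?_, ?_⟩
    · rw [he, hcm] at h1
      omega
    · rw [← hxm]; exact h3.2
    · omega

end WeightedNetwork

namespace SSSPParams

open CongestAlgorithm WeightedNetwork

variable {n a R : ℕ} {P : SSSPParams} {N : WeightedNetwork n a} {s : N.V} {e h M : ℕ}

open Classical in
/-- A random sample is small and hits all shortest paths, except with probability `2 * δ`. -/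
theorem card_bad_sample_le (hq : P.q ≤ R) {δ : ℝ} (hδ : 0 ≤ δ)
    (hh : h < n → n * Real.exp (-(1 / 2 ^ P.q * h)) ≤ δ)
    (hM : M < n → Real.exp (1 / 2 ^ P.q * n) / 2 ^ M ≤ δ) :
    ((Finset.univ.filter fun ω : N.V → Fin R → Bool =>
      ¬ ((P.skeleton s e ω).card ≤ M ∧ P.Hit s e ω h)).card : ℝ) ≤
      2 * δ * Fintype.card (N.V → Fin R → Bool) := by
  set G := Finset.univ.filter fun b : Fin R → Bool => ∀ i : Fin R, (i : ℕ) < P.q → b i = true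
    with hG
  have hGp := card_prefix_true hq
  have hp1 : (1 / 2 ^ P.q : ℝ) ≤ 1 := by
    rw [div_le_one (by positivity)]
    exact one_le_pow₀ one_le_two
  have hsk : ∀ (ω : N.V → Fin R → Bool) v, ω v ∈ G → v ∈ P.skeleton s e ω := by
    intro ω v hv
    exact mem_skeleton.2 (Or.inr (Finset.mem_filter.1 hv).2)
  -- When the source is not reached within `h` hops, `A v` consists of the `h` vertices before `v`
  -- on a shortest path; a sample that meets `A v` takes care of `v`.
  choose A hA using fun v : N.V => (show ∃ A : Finset N.V,
      (¬ ∃ l ≤ h, WPath N.edge s l v (N.wdist s v)) → A.card = h ∧ h < n ∧ ∀ u ∈ A, u ≠ v ∧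
      ∃ l ≤ h, ∃ W, WPath N.edge u l v W ∧ N.wdist s u + W = N.wdist s v by
    by_cases hc : ∃ l ≤ h, WPath N.edge s l v (N.wdist s v)
    · exact ⟨∅, fun h => absurd hc h⟩
    · obtain ⟨A, hA⟩ := (exists_predecessors s v h).resolve_left hc
      exact ⟨A, fun _ => hA⟩)
  let big := Finset.univ.filter fun ω : N.V → Fin R → Bool =>
    M ≤ (Finset.univ.filter fun v => ω v ∈ G).card ∧ M < n
  let miss := fun v => Finset.univ.filter fun ω : N.V → Fin R → Bool =>
    (A v).card = h ∧ h < n ∧ ∀ u ∈ A v, ω u ∉ G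
  have hsub : (Finset.univ.filter fun ω : N.V → Fin R → Bool =>
      ¬ ((P.skeleton s e ω).card ≤ M ∧ P.Hit s e ω h)) ⊆ big ∪ Finset.univ.biUnion miss := by
    intro ω hω
    rw [Finset.mem_filter] at hω
    rw [Finset.mem_union]
    by_contra hnot
    push Not at hnot
    obtain ⟨hbig, hmiss⟩ := hnot
    refine hω.2 ⟨?_, fun v hv => ?_⟩
    · by_contra hlt
      rw [not_le] at hlt
      refine hbig (Finset.mem_filter.2 ⟨Finset.mem_univ _, ?_, ?_⟩)
      -- The source is sampled regardless of its coins, so more than `M` sampled nodes still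
      -- guarantee `M` by coins.
      · have : P.skeleton s e ω ⊆ insert s (Finset.univ.filter fun v => ω v ∈ G) := by
          intro v hv
          rcases mem_skeleton.1 hv with h1 | h1
          · exact Finset.mem_insert.2 (Or.inl (Subtype.ext h1))
          · exact Finset.mem_insert_of_mem (Finset.mem_filter.2 ⟨Finset.mem_univ _,
              Finset.mem_filter.2 ⟨Finset.mem_univ _, h1⟩⟩)
        have := (Finset.card_le_card this).trans (Finset.card_insert_le _ _)
        omega
      · refine hlt.trans_le ((Finset.card_le_univ _).trans ?_)
        rw [Fintype.card_coe, N.card_V]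
    · by_cases hc : ∃ l ≤ h, WPath N.edge s l v (N.wdist s v)
      · obtain ⟨l, hl, q⟩ := hc
        exact ⟨s, source_mem_skeleton, hv.symm, l, hl, _, q, by rw [wdist_self, zero_add]⟩
      · obtain ⟨h1, h2, h3⟩ := hA v hc
        have h4 : ω ∉ miss v := fun h => hmiss (Finset.mem_biUnion.2 ⟨v, Finset.mem_univ _, h⟩)
        have h5 : ∃ u ∈ A v, ω u ∈ G := by
          by_contra hn
          push Not at hn
          exact h4 (Finset.mem_filter.2 ⟨Finset.mem_univ _, h1, h2, hn⟩)
        obtain ⟨u, hu, huG⟩ := h5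
        exact ⟨u, hsk ω u huG, h3 u hu⟩
  have hbig : (big.card : ℝ) ≤ δ * Fintype.card (N.V → Fin R → Bool) := by
    by_cases hMn : M < n
    · have h1 := card_large_le (V := N.V) G hGp (by positivity) M
      rw [Fintype.card_coe, N.card_V] at h1
      refine le_trans ?_ (h1.trans (mul_le_mul_of_nonneg_right (hM hMn) (by positivity)))
      exact_mod_cast Finset.card_le_card fun ω hω => by
        simp only [big, Finset.mem_filter] at hω ⊢
        exact ⟨hω.1, hω.2.1⟩
    · have : big = ∅ := by
        refine Finset.filter_eq_empty_iff.2 fun ω _ h => hMn h.2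
      rw [this, Finset.card_empty, Nat.cast_zero]
      positivity
  have hmiss : ((Finset.univ.biUnion miss).card : ℝ) ≤
      δ * Fintype.card (N.V → Fin R → Bool) := by
    by_cases hhn : h < n
    · have h1 : ∀ v, ((miss v).card : ℝ) ≤
          Real.exp (-(1 / 2 ^ P.q * h)) * Fintype.card (N.V → Fin R → Bool) := by
        intro v
        by_cases hv : (A v).card = h
        · have h1 := card_avoid_le (V := N.V) G hGp hp1 (A v)
          rw [hv] at h1
          refine le_trans ?_ h1
          exact_mod_cast Finset.card_le_card fun ω hω => by
            simp only [miss, Finset.mem_filter] at hω ⊢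
            exact ⟨hω.1, hω.2.2.2⟩
        · have : miss v = ∅ := Finset.filter_eq_empty_iff.2 fun ω _ h => hv h.1
          rw [this, Finset.card_empty, Nat.cast_zero]
          positivity
      calc ((Finset.univ.biUnion miss).card : ℝ) ≤ ∑ v, ((miss v).card : ℝ) := by
            exact_mod_cast Finset.card_biUnion_le
        _ ≤ ∑ _v : N.V, Real.exp (-(1 / 2 ^ P.q * h)) * Fintype.card (N.V → Fin R → Bool) :=
            Finset.sum_le_sum fun v _ => h1 v
        _ = n * Real.exp (-(1 / 2 ^ P.q * h)) * Fintype.card (N.V → Fin R → Bool) := by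
            rw [Finset.sum_const, Finset.card_univ, Fintype.card_coe, N.card_V, nsmul_eq_mul,
              mul_assoc]
        _ ≤ _ := mul_le_mul_of_nonneg_right (hh hhn) (by positivity)
    · have : Finset.univ.biUnion miss = ∅ := by
        refine Finset.eq_empty_of_forall_notMem fun ω hω => ?_
        obtain ⟨v, -, hv⟩ := Finset.mem_biUnion.1 hω
        exact hhn (Finset.mem_filter.1 hv).2.2.1
      rw [this, Finset.card_empty, Nat.cast_zero]
      positivity
  have hfin : ((big ∪ Finset.univ.biUnion miss).card : ℝ) ≤
      big.card + (Finset.univ.biUnion miss).card := by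
    exact_mod_cast Finset.card_union_le _ _
  have hle : ((Finset.univ.filter fun ω : N.V → Fin R → Bool =>
      ¬ ((P.skeleton s e ω).card ≤ M ∧ P.Hit s e ω h)).card : ℝ) ≤
      (big ∪ Finset.univ.biUnion miss).card := by
    exact_mod_cast Finset.card_le_card hsub
  linarith

end SSSPParams

open Classical in
theorem one_sub_le_uniformOn {Ω : Type*} [Fintype Ω] [Nonempty Ω] [MeasurableSpace Ω]
    [MeasurableSingletonClass Ω] {s : Set Ω} {bad : Finset Ω} {δ : ℝ}
    (hs : ∀ ω, ω ∉ bad → ω ∈ s) (hbad : (bad.card : ℝ) ≤ δ * Fintype.card Ω) :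
    1 - δ ≤ (uniformOn (Set.univ : Set Ω)).real s := by
  have hpos : (0 : ℝ) < Fintype.card Ω := by exact_mod_cast Fintype.card_pos
  have hsub : ((badᶜ : Finset Ω) : Set Ω) ⊆ s := fun ω hω => hs ω (by simpa using hω)
  have := isProbabilityMeasure_uniformOn (Set.finite_univ (α := Ω)) Set.univ_nonempty
  refine le_trans ?_ (MeasureTheory.measureReal_mono hsub)
  rw [MeasureTheory.Measure.real, uniformOn_univ, MeasureTheory.Measure.count_apply_finset,
    ENNReal.toReal_div, ENNReal.toReal_natCast, ENNReal.toReal_natCast, Finset.card_compl,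
    Nat.cast_sub (Finset.card_le_univ _), le_div_iff₀ hpos]
  linarith

/-! ### The choice of the parameters -/

section Parameters

variable (n a c e : ℕ)

/-- The exponent of two for the inverse sampling probability. -/
def sampleExp : ℕ := Nat.log 16 (n ^ 2 * e)

/-- The number of hops after which a shortest path meets the sample. -/
def hopBound : ℕ := min n ((c + 2) * Nat.clog 2 n * 2 ^ sampleExp n e)

/-- The bound for the size of the sample. -/
def sampleBound : ℕ := min n (2 * (n / 2 ^ sampleExp n e + 1) + (c + 1) * Nat.clog 2 n)

/-- The parameters for `n` nodes, the exponent `c` of the failure probability, and the estimate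
`e` of the diameter. -/
def ssspParams : SSSPParams where
  I := (a + 3) * Nat.clog 2 n
  L := hopBound n c e * (Nat.clog 2 n + 1)
  Z := 2 ^ ((a + 1) * Nat.clog 2 n)
  k := Nat.sqrt e
  D := e + 1
  q := sampleExp n e

/-- The length of a phase. -/
def phaseLength : ℕ :=
  hopBound n c e * (Nat.clog 2 n + 1) + sampleBound n c e + e + sampleBound n c e * Nat.sqrt e +
    (e + 1) * ((5 * (sampleBound n c e / (Nat.sqrt e + 1)) + 2) * (Nat.clog 2 n + 1))

end Parameters

namespace WeightedNetwork

variable {n a : ℕ} (N : WeightedNetwork n a)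

theorem one_le_card (N : WeightedNetwork n a) : 1 ≤ n := by
  obtain ⟨v⟩ := N.connected.nonempty
  rw [← N.card_V]
  exact Finset.card_pos.2 ⟨v, v.2⟩

theorem hopDiam_le : N.hopDiam ≤ n := by
  classical
  have := N.connected.nonempty
  obtain ⟨u, v, huv⟩ := N.graph.exists_dist_eq_diam
  rw [hopDiam, ← huv]
  obtain ⟨p⟩ := N.connected.preconnected u v
  have hp := (SimpleGraph.Walk.bypass_isPath p).length_lt
  rw [Fintype.card_coe, N.card_V] at hp
  exact (SimpleGraph.dist_le _).trans hp.le

theorem one_le_hopDiam (hn : 2 ≤ n) : 1 ≤ N.hopDiam := by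
  have : Nontrivial N.V := by
    rw [← Fintype.one_lt_card_iff_nontrivial, Fintype.card_coe, N.card_V]
    omega
  have := N.connected.nonempty
  exact Nat.one_le_iff_ne_zero.2 (SimpleGraph.diam_ne_zero_of_ediam_ne_top
    (SimpleGraph.connected_iff_ediam_ne_top.1 N.connected))

end WeightedNetwork

/-- All quantities are bounded by powers of `X = 2 ^ b ≥ n`: a phase has at most `X ^ 8` rounds and
the codes stay below `X ^ (3 * a + 8)`. The product gives the bandwidth exponent `3 * a + 16`. -/
theorem fits_ssspParams {n a c e : ℕ} (hn : 2 ≤ n) (N : WeightedNetwork n a)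
    (he : N.hopDiam ≤ e) (he' : e ≤ 2 * N.hopDiam) :
    (ssspParams n a c e).Fits N ((3 * a + 16) * Nat.clog 2 n) (2 ^ ((3 * a + 8) * Nat.clog 2 n))
      (phaseLength n c e) (hopBound n c e) (Nat.clog 2 n) (sampleBound n c e) := by
  have hD := N.hopDiam_le
  have hD1 := N.one_le_hopDiam hn
  have hnX : n ≤ 2 ^ Nat.clog 2 n := Nat.le_pow_clog (by norm_num) n
  have hb : 1 ≤ Nat.clog 2 n := Nat.clog_pos (by norm_num) hn
  have hbX : Nat.clog 2 n + 1 ≤ 2 ^ Nat.clog 2 n := Nat.lt_two_pow_self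
  have hh : hopBound n c e ≤ n := min_le_left _ _
  have hM : sampleBound n c e ≤ n := min_le_left _ _
  set b := Nat.clog 2 n with hbdef
  set X := 2 ^ b with hX
  have hX2 : 2 ≤ X := hn.trans hnX
  have hpow : ∀ m, 2 ^ (m * b) = X ^ m := fun m => by rw [hX, ← pow_mul, mul_comm]
  have hsq : Nat.sqrt e ≤ e := Nat.sqrt_le_self e
  have hL : hopBound n c e * (b + 1) ≤ X ^ 2 := by
    rw [pow_two]; exact Nat.mul_le_mul (hh.trans hnX) hbX
  have hτ : phaseLength n c e ≤ X ^ 8 := by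
    have h1 : sampleBound n c e * Nat.sqrt e ≤ X * (2 * X) :=
      Nat.mul_le_mul (hM.trans hnX) (by omega)
    have h2 : sampleBound n c e / (Nat.sqrt e + 1) ≤ X :=
      (Nat.div_le_self _ _).trans (hM.trans hnX)
    have h3 : (e + 1) * ((5 * (sampleBound n c e / (Nat.sqrt e + 1)) + 2) * (b + 1)) ≤
        3 * X * ((6 * X) * X) :=
      Nat.mul_le_mul (by omega) (Nat.mul_le_mul (by omega) hbX)
    have h4 : X ^ 2 * 2 ≤ X ^ 3 := by rw [pow_succ X 2]; exact Nat.mul_le_mul_left _ hX2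
    have h5 : X * 2 ≤ X ^ 2 := by rw [pow_two]; exact Nat.mul_le_mul_left _ hX2
    have h6 : X ^ 3 * 2 ^ 5 ≤ X ^ 8 := by
      rw [show X ^ 8 = X ^ 3 * X ^ 5 by ring]
      exact Nat.mul_le_mul_left _ (Nat.pow_le_pow_left hX2 5)
    have h7 : X * (2 * X) = 2 * X ^ 2 := by ring
    have h8 : 3 * X * (6 * X * X) = 18 * X ^ 3 := by ring
    rw [phaseLength, ← hbdef]
    omega
  refine ⟨fun v => ?_, ?_, ?_, Nat.sqrt_pos.2 (by omega), hb, rfl, Nat.lt_succ_of_le he, ?_,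
    ?_, ?_, ?_⟩
  · have h1 := (Finset.mem_Icc.1 (N.id_range v.2)).2
    refine h1.trans_lt ?_
    show n ^ a < 2 ^ ((a + 1) * b)
    rw [hpow]
    exact (Nat.pow_le_pow_left hnX a).trans_lt (Nat.pow_lt_pow_right hX2 (Nat.lt_succ_self a))
  · show 2 ^ ((a + 1) * b) * (2 ^ ((a + 1) * b) *
      (2 ^ ((a + 3) * b) * (hopBound n c e * (b + 1)) + 1)) ≤ 2 ^ ((3 * a + 8) * b)
    simp only [hpow]
    calc X ^ (a + 1) * (X ^ (a + 1) * (X ^ (a + 3) * (hopBound n c e * (b + 1)) + 1))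
        ≤ X ^ (a + 1) * (X ^ (a + 1) * (X ^ (a + 3) * X ^ 2 + X ^ (a + 3) * X ^ 2)) := by
          gcongr
          exact Nat.mul_pos (by positivity) (by positivity)
      _ = 2 * (X ^ (a + 1) * (X ^ (a + 1) * (X ^ (a + 3) * X ^ 2))) := by ring
      _ ≤ X * (X ^ (a + 1) * (X ^ (a + 1) * (X ^ (a + 3) * X ^ 2))) := by gcongr
      _ = X ^ (3 * a + 8) := by ring
  · calc phaseLength n c e * 2 ^ ((3 * a + 8) * b)
        ≤ X ^ 8 * X ^ (3 * a + 8) := by rw [hpow]; exact Nat.mul_le_mul_right _ hτ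
      _ = 2 ^ ((3 * a + 16) * b) := by rw [hpow]; ring
  · show 3 * (n * n ^ a) ≤ 2 ^ ((a + 3) * b)
    rw [hpow]
    calc 3 * (n * n ^ a) ≤ (X * X) * (X * X ^ a) := by gcongr; nlinarith
      _ = X ^ (a + 3) := by ring
  · show hopBound n c e * (b + 1) + sampleBound n c e ≤ phaseLength n c e
    rw [phaseLength, ← hbdef]
    omega
  · show N.hopDiam + sampleBound n c e * Nat.sqrt e ≤ phaseLength n c e
    rw [phaseLength, ← hbdef]
    omega
  · show (e + 1) * ((5 * (sampleBound n c e / (Nat.sqrt e + 1)) + 2) * (b + 1)) + N.hopDiam +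
      sampleBound n c e ≤ phaseLength n c e
    rw [phaseLength, ← hbdef]
    omega

/-! ### Failure probability and running time for the chosen parameters -/

theorem two_pow_neg_clog_le {n m : ℕ} (hn : 1 ≤ n) :
    (1 : ℝ) / 2 ^ (m * Nat.clog 2 n) ≤ 1 / (n : ℝ) ^ m := by
  have h : (n : ℝ) ≤ 2 ^ Nat.clog 2 n := by exact_mod_cast Nat.le_pow_clog (by norm_num) n
  rw [mul_comm, pow_mul]
  have : (0 : ℝ) < n := by exact_mod_cast hn
  gcongr

/-- The exponent is `(c + 2) * log`. One factor of `n` pays for the union bound and one more, being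
at least 2, for halving the error. -/
theorem hopBound_spec {n c e : ℕ} (hn : 2 ≤ n) (h : hopBound n c e < n) :
    -- The assumption `hopBound n c e < n` excludes the cap in the minimum.
    n * Real.exp (-(1 / 2 ^ sampleExp n e * hopBound n c e)) ≤ 1 / (2 * (n : ℝ) ^ c) := by
  have hh : hopBound n c e = (c + 2) * Nat.clog 2 n * 2 ^ sampleExp n e := by
    unfold hopBound at h ⊢
    omega
  have hn0 : (0 : ℝ) < n := by positivity
  have h1 : (1 / 2 ^ sampleExp n e * hopBound n c e : ℝ) = ((c + 2) * Nat.clog 2 n : ℕ) := by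
    rw [hh]; push_cast; field_simp
  have h2 : Real.exp (-(((c + 2) * Nat.clog 2 n : ℕ) : ℝ)) ≤
      1 / 2 ^ ((c + 2) * Nat.clog 2 n) := by
    rw [Real.exp_neg, ← one_div, ← mul_one (((c + 2) * Nat.clog 2 n : ℕ) : ℝ), Real.exp_nat_mul]
    have : (2 : ℝ) ≤ Real.exp 1 := by linarith [Real.add_one_le_exp (1 : ℝ)]
    gcongr
  rw [h1]
  calc n * Real.exp (-(((c + 2) * Nat.clog 2 n : ℕ) : ℝ)) ≤ n * (1 / (n : ℝ) ^ (c + 2)) := by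
        gcongr
        exact h2.trans (two_pow_neg_clog_le (by omega))
    _ = 1 / (n * (n : ℝ) ^ c) := by rw [pow_add]; field_simp
    _ ≤ 1 / (2 * (n : ℝ) ^ c) := by
        have : (2 : ℝ) ≤ n := by exact_mod_cast hn
        gcongr

theorem sampleBound_spec {n c e : ℕ} (hn : 2 ≤ n) (h : sampleBound n c e < n) :
    Real.exp (1 / 2 ^ sampleExp n e * n) / 2 ^ sampleBound n c e ≤ 1 / (2 * (n : ℝ) ^ c) := by
  have hn0 : (0 : ℝ) < n := by positivity
  set m := n / 2 ^ sampleExp n e with hm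
  have hM : sampleBound n c e = 2 * (m + 1) + (c + 1) * Nat.clog 2 n := by
    unfold sampleBound at h ⊢
    omega
  have h1 : (1 / 2 ^ sampleExp n e * n : ℝ) ≤ ((m + 1 : ℕ) : ℝ) := by
    rw [one_div_mul_eq_div, div_le_iff₀ (by positivity)]
    have := (Nat.lt_mul_div_succ n (Nat.two_pow_pos (sampleExp n e))).le
    rw [mul_comm] at this
    exact_mod_cast this
  -- Since `e < 4`, the summand `2 * (m + 1)` in the sample bound absorbs the exponential moment.
  have h2 : Real.exp ((m + 1 : ℕ) : ℝ) ≤ 2 ^ (2 * (m + 1)) := by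
    rw [← mul_one (((m + 1 : ℕ)) : ℝ), Real.exp_nat_mul, pow_mul]
    have := Real.exp_one_lt_d9
    gcongr
    norm_num
    linarith
  rw [hM, pow_add]
  calc Real.exp (1 / 2 ^ sampleExp n e * n) / (2 ^ (2 * (m + 1)) * 2 ^ ((c + 1) * Nat.clog 2 n))
      ≤ 2 ^ (2 * (m + 1)) / (2 ^ (2 * (m + 1)) * 2 ^ ((c + 1) * Nat.clog 2 n)) := by
        gcongr
        exact (Real.exp_le_exp.2 h1).trans h2
    _ = 1 / 2 ^ ((c + 1) * Nat.clog 2 n) := by field_simp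
    _ ≤ 1 / (n : ℝ) ^ (c + 1) := two_pow_neg_clog_le (by omega)
    _ ≤ 1 / (2 * (n : ℝ) ^ c) := by
        have : (2 : ℝ) ≤ n := by exact_mod_cast hn
        rw [pow_succ']
        gcongr

theorem clog_le_log {n : ℕ} (hn : 2 ≤ n) : (Nat.clog 2 n : ℝ) ≤ 3 * Real.log n := by
  have h1 : (2 : ℝ) ^ (Nat.clog 2 n - 1) ≤ n := by
    exact_mod_cast (Nat.pow_pred_clog_lt_self (by norm_num) hn).le
  have hb : 1 ≤ Nat.clog 2 n := Nat.clog_pos (by norm_num) hn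
  have h2 := Real.log_le_log (by positivity) h1
  rw [Real.log_pow, Nat.cast_sub hb] at h2
  have h3 : Real.log 2 ≤ Real.log n := Real.log_le_log (by norm_num) (by exact_mod_cast hn)
  have h4 := Real.log_two_gt_d9
  have hb' : (1 : ℝ) ≤ Nat.clog 2 n := by exact_mod_cast hb
  push_cast at h2
  nlinarith

/-- With `Y = n^{1/2} D^{1/4}`, the inverse sampling probability `x` lies within a factor 2 of `Y`.
As `Y ^ 2 = n * √D`, the expected sample size `u = n / x` satisfies `u * √D ≤ 2 * Y`; this bounds
both `M * k` and `D * M / k` for `k ≈ √D`. The additive logarithm in `M` contributes only to the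
multiple of `D`. -/
theorem phaseLength_le {n c e D : ℕ} (hn : 2 ≤ n) (hD : 1 ≤ D) (he : D ≤ e) (he' : e ≤ 2 * D) :
    (phaseLength n c e : ℝ) ≤ 100 * (c + 3) * (Nat.clog 2 n : ℝ) ^ 2 *
      ((n : ℝ) ^ (1 / 2 : ℝ) * (D : ℝ) ^ (1 / 4 : ℝ) + D) := by
  have hn0 : (0 : ℝ) < n := by positivity
  have hD1 : (1 : ℝ) ≤ D := by exact_mod_cast hD
  have heD : (D : ℝ) ≤ e := by exact_mod_cast he
  have heD' : (e : ℝ) ≤ 2 * D := by exact_mod_cast he'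
  set Y := (n : ℝ) ^ (1 / 2 : ℝ) * (D : ℝ) ^ (1 / 4 : ℝ) with hY
  set S := Real.sqrt D with hS
  have hS2 : S ^ 2 = D := Real.sq_sqrt (by linarith)
  have hS1 : 1 ≤ S := by rw [hS]; exact Real.one_le_sqrt.2 hD1
  have hY0 : 0 < Y := by positivity
  have hY2 : Y ^ 2 = n * S := by
    rw [hY, mul_pow, ← Real.rpow_natCast, ← Real.rpow_mul hn0.le, ← Real.rpow_natCast,
      ← Real.rpow_mul (by linarith), hS, Real.sqrt_eq_rpow]
    norm_num
  set b : ℝ := (Nat.clog 2 n : ℝ) with hb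
  have hb1 : 1 ≤ b := by
    rw [hb]; exact_mod_cast Nat.clog_pos (by norm_num) hn
  set x : ℝ := 2 ^ sampleExp n e with hx
  have hx0 : 0 < x := by positivity
  -- The logarithm to base 16 of `n ^ 2 * e` is chosen so that `x ^ 4` approximates `n ^ 2 * e`
  -- within a factor 16.
  have hx4 : x ^ 4 = 16 ^ sampleExp n e := by
    rw [hx, ← pow_mul, mul_comm, pow_mul]; norm_num
  have hne : n ^ 2 * e ≠ 0 := by
    have : 0 < n ^ 2 * e := Nat.mul_pos (by positivity) (by omega)
    omega
  have hY4 : Y ^ 4 = (n : ℝ) ^ 2 * D := by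
    rw [show Y ^ 4 = (Y ^ 2) ^ 2 by ring, hY2, mul_pow, hS2]
  have hxle : x ≤ 2 * Y := by
    refine le_of_pow_le_pow_left₀ (n := 4) (by norm_num) (by positivity) ?_
    rw [hx4, mul_pow, hY4]
    have h1 : (16 : ℝ) ^ sampleExp n e ≤ (n : ℝ) ^ 2 * e := by
      exact_mod_cast Nat.pow_log_le_self 16 hne
    have h2 := mul_le_mul_of_nonneg_left heD' (sq_nonneg (n : ℝ))
    have h3 := mul_nonneg (sq_nonneg (n : ℝ)) (by linarith : (0 : ℝ) ≤ D)
    linarith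
  have hYle : Y ≤ 2 * x := by
    refine le_of_pow_le_pow_left₀ (n := 4) (by norm_num) (by positivity) ?_
    rw [hY4, mul_pow, hx4]
    have h1 : (n : ℝ) ^ 2 * e ≤ 16 ^ sampleExp n e * 16 := by
      have := (Nat.lt_pow_succ_log_self (b := 16) (by norm_num) (n ^ 2 * e)).le
      rw [Nat.succ_eq_add_one, pow_succ] at this
      exact_mod_cast this
    have h2 := mul_le_mul_of_nonneg_left heD (sq_nonneg (n : ℝ))
    linarith
  set u : ℝ := n / x with hu
  have hu0 : 0 ≤ u := by positivity
  have huS : u * S ≤ 2 * Y := by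
    rw [hu, div_mul_eq_mul_div, ← hY2, div_le_iff₀ hx0, pow_two]
    have := mul_le_mul_of_nonneg_left hYle hY0.le
    linarith
  set M : ℝ := (sampleBound n c e : ℝ) with hM
  set g : ℝ := (c + 3) * b with hg
  have hc0 : (0 : ℝ) ≤ c := Nat.cast_nonneg c
  have hg1 : 3 ≤ g := by
    rw [hg]
    nlinarith only [hc0, hb1]
  have hMle : M ≤ 2 * u + g := by
    have h1 : (sampleBound n c e : ℝ) ≤
        ((2 * (n / 2 ^ sampleExp n e + 1) + (c + 1) * Nat.clog 2 n : ℕ) : ℝ) := by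
      exact_mod_cast min_le_right _ _
    have h2 : ((n / 2 ^ sampleExp n e : ℕ) : ℝ) ≤ u := by
      have := Nat.cast_div_le (α := ℝ) (m := n) (n := 2 ^ sampleExp n e)
      rw [hu, hx]
      exact_mod_cast this
    push_cast at h1
    rw [hM, hg]
    linarith
  have hM0 : 0 ≤ M := Nat.cast_nonneg _
  set k : ℝ := (Nat.sqrt e : ℝ) with hk
  have hk0 : 0 ≤ k := Nat.cast_nonneg _
  have hk1 : 1 ≤ k := by
    rw [hk]; exact_mod_cast Nat.sqrt_pos.2 (by omega)
  have hkS : k ≤ 2 * S := by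
    have h1 : k ^ 2 ≤ e := by rw [hk]; exact_mod_cast Nat.sqrt_le' e
    nlinarith only [h1, heD', hS2, hk0, hS1]
  have hSk : S ≤ k + 1 := by
    have h1 : (e : ℝ) ≤ (k + 1) ^ 2 := by
      rw [hk]; exact_mod_cast (Nat.lt_succ_sqrt' e).le
    nlinarith only [h1, heD, hS2, hk0, hS1]
  have hSD : S ≤ D := by nlinarith only [hS1, hS2]
  have hMS : M * S ≤ 4 * Y + g * D := by
    have h1 := mul_le_mul_of_nonneg_right hMle (by linarith : 0 ≤ S)
    have h2 := mul_le_mul_of_nonneg_left hSD (by linarith : 0 ≤ g)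
    linarith
  have hMk : M * k ≤ 8 * Y + 2 * g * D := by
    have := mul_le_mul_of_nonneg_left hkS hM0
    linarith
  have hMM : M ≤ 4 * Y + g * D := by
    have := mul_le_mul_of_nonneg_left hS1 hM0
    linarith
  have hh : (hopBound n c e : ℝ) ≤ g * (2 * Y) := by
    have h1 : (hopBound n c e : ℝ) ≤
        (((c + 2) * Nat.clog 2 n * 2 ^ sampleExp n e : ℕ) : ℝ) := by
      exact_mod_cast min_le_right _ _
    push_cast at h1
    refine h1.trans (mul_le_mul ?_ hxle (by positivity) (by linarith))
    rw [hg]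
    linarith
  have hH : ((e : ℝ) + 1) * (5 * ((sampleBound n c e / (Nat.sqrt e + 1) : ℕ) : ℝ) + 2) ≤
      15 * (4 * Y + g * D) + 6 * D := by
    set d : ℝ := ((sampleBound n c e / (Nat.sqrt e + 1) : ℕ) : ℝ) with hd
    have hd0 : 0 ≤ d := Nat.cast_nonneg _
    have h1 : d * (k + 1) ≤ M := by
      rw [hd, hk, hM]
      exact_mod_cast Nat.div_mul_le_self _ _
    have h2 : d * S ≤ M := (mul_le_mul_of_nonneg_left hSk hd0).trans h1
    have h3 : d * D ≤ M * S := by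
      rw [← hS2]
      have := mul_le_mul_of_nonneg_right h2 (by linarith : 0 ≤ S)
      linarith
    have h4 : (e : ℝ) + 1 ≤ 3 * D := by linarith
    have h5 := mul_le_mul_of_nonneg_right h4 (by positivity : 0 ≤ 5 * d + 2)
    linarith
  have hF : (phaseLength n c e : ℝ) = (hopBound n c e : ℝ) * (b + 1) + M + e + M * k +
      ((e : ℝ) + 1) * (5 * ((sampleBound n c e / (Nat.sqrt e + 1) : ℕ) : ℝ) + 2) * (b + 1) := by
    rw [phaseLength, hM, hk, hb]
    push_cast
    ring
  have hb2 : b + 1 ≤ 2 * b := by linarith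
  have hgD : 0 ≤ g * D := by positivity
  have e1 : (hopBound n c e : ℝ) * (b + 1) ≤ g * (2 * Y) * (2 * b) :=
    mul_le_mul hh hb2 (by linarith) (by positivity)
  have e2 := mul_le_mul hH hb2 (by linarith) (by positivity)
  have hgb : g * b = (c + 3) * b ^ 2 := by rw [hg]; ring
  set E := (c + 3) * b ^ 2 with hE
  have hgE : g ≤ E := by rw [← hgb]; nlinarith only [hg1, hb1]
  have hbE : 3 * b ≤ E := by rw [← hgb]; nlinarith only [hg1, hb1]
  have t1 : g * D ≤ E * D := by gcongr
  have t2 : 3 * b * Y ≤ E * Y := by gcongr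
  have t3 : 3 * b * D ≤ E * D := by gcongr
  have t4 : 3 * Y ≤ E * Y := by
    refine mul_le_mul_of_nonneg_right ?_ hY0.le
    linarith
  have t5 : 3 * D ≤ E * D := by
    refine mul_le_mul_of_nonneg_right ?_ (by linarith)
    linarith
  have e1' : g * (2 * Y) * (2 * b) = 4 * (E * Y) := by rw [← hgb]; ring
  have e2' : (15 * (4 * Y + g * D) + 6 * D) * (2 * b) =
      40 * (3 * b * Y) + 30 * (E * D) + 4 * (3 * b * D) := by rw [← hgb]; ring
  rw [hF, show 100 * ((c : ℝ) + 3) * b ^ 2 * (Y + D) = 100 * (E * Y) + 100 * (E * D) by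
    rw [hE]; ring]
  linarith

theorem tendsto_clog_atTop : Tendsto (fun n => Nat.clog 2 n) atTop atTop := by
  refine tendsto_atTop_atTop.2 fun m => ⟨2 ^ m, fun n hn => ?_⟩
  rw [← Nat.clog_pow 2 m (by norm_num)]
  exact Nat.clog_mono_right 2 hn

theorem tendsto_precision :
    Tendsto (fun n : ℕ => (((Nat.clog 2 n : ℝ) + 2) / Nat.clog 2 n) ^ 2 - 1) atTop (𝓝 0) := by
  have h1 : Tendsto (fun b : ℕ => ((1 : ℝ) + 2 / b) ^ 2 - 1) atTop (𝓝 ((1 + 0) ^ 2 - 1)) :=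
    (((tendsto_const_div_atTop_nhds_zero_nat 2).const_add 1).pow 2).sub_const 1
  rw [show ((1 : ℝ) + 0) ^ 2 - 1 = 0 by norm_num] at h1
  refine (h1.comp tendsto_clog_atTop).congr' ?_
  filter_upwards [eventually_ge_atTop 2] with n hn
  have hb : (0 : ℝ) < Nat.clog 2 n := by exact_mod_cast Nat.clog_pos (by norm_num) hn
  simp only [Function.comp]
  rw [add_div, div_self hb.ne']

end
theorem theorem1 (a : ℕ) :
    -- the messages have `β * ⌈log₂ n⌉ = O(log n)` bits
    ∃ β : ℕ, ∀ c : ℕ,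
      ∃ (R : ℕ → ℕ) (A : ∀ n : ℕ, CongestAlgorithm (β * Nat.clog 2 n) (R n))
        (ε : ℕ → ℝ) (C : ℝ) (k : ℕ),
        Tendsto ε atTop (𝓝 0) ∧
        ∀ (n : ℕ) (N : WeightedNetwork n a) (s : N.V) (diamEst : ℕ),
          N.hopDiam ≤ diamEst → diamEst ≤ 2 * N.hopDiam →
          1 - 1 / (n : ℝ) ^ c ≤
            (uniformOn (Set.univ : Set (N.V → Fin (R n) → Bool))).real
              {ω | (A n).SolvesSSSPWithin N s diamEst ω (1 + ε n)
                (C * Real.log n ^ k *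
                  ((n : ℝ) ^ (1 / 2 : ℝ) * (N.hopDiam : ℝ) ^ (1 / 4 : ℝ) + N.hopDiam))} := by
  classical
  refine ⟨3 * a + 16, fun c => ⟨fun n => n ^ 2 * (2 * n), fun n =>
    ssspAlgorithm _ _ (2 ^ ((3 * a + 8) * Nat.clog 2 n)) ((a + 3) * Nat.clog 2 n)
      (phaseLength n c) (ssspParams n a c),
    fun n => (((Nat.clog 2 n : ℝ) + 2) / Nat.clog 2 n) ^ 2 - 1,
    2700 * (2 * a + 9) * (c + 3), 3, tendsto_precision, fun n N s e he he' => ?_⟩⟩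
  -- For `n = 1` the required probability is 0; a network has at least one node.
  rcases Nat.lt_or_ge n 2 with hn | hn
  · obtain rfl : n = 1 := by have := N.one_le_card; omega
    simp only [Nat.cast_one, one_pow, div_one, sub_self]
    exact MeasureTheory.measureReal_nonneg
  have hD := N.hopDiam_le
  have hD1 := N.one_le_hopDiam hn
  have hfit := fits_ssspParams (c := c) hn N he he'
  -- The number of coins must be fixed before the diameter estimate is known, hence a bound for
  -- every `e ≤ 2 * n`.
  have hq : (ssspParams n a c e).q ≤ n ^ 2 * (2 * n) :=
    (Nat.log_le_self 16 (n ^ 2 * e)).trans (Nat.mul_le_mul_left _ (by omega))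
  have hbad := SSSPParams.card_bad_sample_le (s := s) (e := e) (P := ssspParams n a c e) hq
    (δ := 1 / (2 * (n : ℝ) ^ c)) (by positivity) (hopBound_spec (c := c) (e := e) hn)
    (sampleBound_spec (c := c) (e := e) hn)
  have hδ : 2 * (1 / (2 * (n : ℝ) ^ c)) = 1 / (n : ℝ) ^ c := by field_simp
  rw [hδ] at hbad
  refine one_sub_le_uniformOn (fun ω hω => ?_) hbad
  have hgood : ((ssspParams n a c e).skeleton s e ω).card ≤ sampleBound n c e ∧
      (ssspParams n a c e).Hit s e ω (hopBound n c e) := by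
    simpa only [Finset.mem_filter, Finset.mem_univ, true_and, not_not] using hω
  refine ssspAlgorithm_solves rfl hfit hgood.1 hgood.2 (by rw [add_sub_cancel]) ?_
  have hb : (1 : ℝ) ≤ Nat.clog 2 n := by exact_mod_cast Nat.clog_pos (by norm_num) hn
  have hlog := clog_le_log hn
  have hτ := phaseLength_le (c := c) hn hD1 he he'
  set F := (n : ℝ) ^ (1 / 2 : ℝ) * (N.hopDiam : ℝ) ^ (1 / 4 : ℝ) + N.hopDiam with hF
  have hF0 : 0 ≤ F := by positivity
  set b : ℝ := (Nat.clog 2 n : ℝ) with hbdef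
  have hP : (2 * (((a + 3) * Nat.clog 2 n : ℕ) : ℝ) + 3) ≤ (2 * a + 9) * b := by
    push_cast
    nlinarith
  calc (2 * (((a + 3) * Nat.clog 2 n : ℕ) : ℝ) + 3) * phaseLength n c e
      ≤ ((2 * a + 9) * b) * (100 * (c + 3) * b ^ 2 * F) := by gcongr
    _ = 100 * (2 * a + 9) * (c + 3) * b ^ 3 * F := by ring
    -- One logarithm comes from the number of phases and two from the length of a phase; `2700 = 100
    -- * 3 ^ 3`.
    _ ≤ 100 * (2 * a + 9) * (c + 3) * (3 * Real.log n) ^ 3 * F := by gcongr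
    _ = 2700 * (2 * a + 9) * (c + 3) * Real.log n ^ 3 * F := by ring
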